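/- Let $d\ge 1$ and let $f\in C^2(\mathbb R^d;\mathbb R)$ satisfy $\alpha I_d\preceq\nabla^2 f(x)\preceq\beta I_d$ for all $x\in\mathbb R^d$, where $0<\alpha\le\beta$; let $x^\ast=\operatorname{argmin}_x f(x)$. Let $\eta\in(0,1/\beta)$, and let $m\ge 0$ and $n\ge 1$ be integers. Let $X_0$ be a random vector in $\mathbb R^d$, and let $Z_1,Z_2,\ldots$ be i.i.d. $\mathcal N(0,I_d)$ random vectors, independent of $X_0$. Define the unadjusted Langevin algorithm (ULA) by $$X_i=X_{i-1}-\eta\nabla f(X_{i-1})+\sqrt{2\eta}\,Z_i\quad(i\ge 1),$$ and put $$\bar X_n=\frac1n\sum_{i=m+1}^{m+n}X_i,\qquad \hat\Sigma_n=\frac1n\sum_{i=m+1}^{m+n}X_iX_i^\top-\bar X_n\bar X_n^\top.$$ Let $\|\cdot\|$ denote the operator norm of a matrix and $|\cdot|$ the Euclidean norm. Assume that the distribution $\nu$ of $X_0$ satisfies a log-Sobolev inequality with constant $\kappa_0\ge 0$, that is, for every smooth $g:\mathbb R^d\to\mathbb R$ with $\int g^2|\log|g||\,d\nu<\infty$,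 $$\int g^2\log g^2\,d\nu-\Big(\int g^2\,d\nu\Big)\log\Big(\int g^2\,d\nu\Big)\le 2\kappa_0\int|\nabla g|^2\,d\nu .$$ Suppose that $$m\ \ge\ 0\vee\left(\frac{\log(\kappa_0/\eta)}{\log(1/(1-\alpha\eta))}-1\right)\vee\left(\frac{\log\big(4(\mathbb E[|X_0-x^\ast|^2]+d/\alpha)/(\eta n)\big)}{\log(1/(1-\alpha\eta))}-1\right)$$ (with the convention $\log 0=-\infty$). Then $\mathbb E|X_0-x^\ast|^2$ and $\mathbb E\hat\Sigma_n$ are finite, and for every $\delta>0$, with probability at least $1-4\delta$, $$\big\|\hat\Sigma_n-\mathbb E[\hat\Sigma_n]\big\|\le\frac{16}{\alpha}\left(8\sqrt{\frac{9d+4\log\delta^{-1}}{\alpha\eta n}}\ \vee\ \frac{9d+4\log\delta^{-1}}{\alpha\eta n}\right).$$ In particular, there is a universal constant $C>0$ such that, for every $\delta>0$, with probability at least $1-4\delta$, $$\big\|\hat\Sigma_n-\mathbb E[\hat\Sigma_n]\big\|\le \frac{C}{\alpha}\left(\sqrt{\frac{d+\log\delta^{-1}}{\alpha\eta n}}+\frac{d+\log\delta^{-1}}{\alpha\eta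 n}\right).$$ Consequently, for each $\delta>0$ the rate is of order $(1/\alpha)\sqrt{d/(\alpha\eta n)}$: there is a constant $K_\delta$ depending only on $\delta$ such that, whenever $d\le\alpha\eta n$, $\|\hat\Sigma_n-\mathbb E[\hat\Sigma_n]\|\le K_\delta\,(1/\alpha)\sqrt{d/(\alpha\eta n)}$ with probability at least $1-4\delta$. (For $\delta\ge 1/4$ the three probability statements are void.) -/

import Mathlib

open MeasureTheory ProbabilityTheory

noncomputable section

namespace ULA

/-- The log-Sobolev inequality `LSI(C)`, `C ≥ 0`, for a measure `ν` on `ℝᵈ`: for every smooth `g`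
with `∫ g² |log |g|| dν < ∞`,
`∫ g² log g² dν - (∫ g² dν) log (∫ g² dν) ≤ 2 C ∫ |∇g|² dν`.
When `∫ |∇g|² dν = ∞` the inequality is void, so `|∇g|²` may be taken integrable. For a probability
measure `ν` all the other integrals are then finite. (`Real.log x` is `log |x|`, and
`0 ^ 2 * Real.log 0 = 0`.) -/
def LSI {d : ℕ} (ν : Measure (EuclideanSpace ℝ (Fin d))) (C : ℝ) : Prop :=
  0 ≤ C ∧ ∀ g : EuclideanSpace ℝ (Fin d) → ℝ, ContDiff ℝ (⊤ : ℕ∞) g →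
    Integrable (fun x => g x ^ 2 * |Real.log (g x)|) ν →
    Integrable (fun x => ‖gradient g x‖ ^ 2) ν →
    (∫ x, g x ^ 2 * Real.log (g x ^ 2) ∂ν) - (∫ x, g x ^ 2 ∂ν) * Real.log (∫ x, g x ^ 2 ∂ν)
      ≤ 2 * C * ∫ x, ‖gradient g x‖ ^ 2 ∂ν

/-- `f` is `C²` with `α I ⪯ ∇²f(x) ⪯ β I` for all `x`, where `0 < α ≤ β`. The Loewner order is
spelled out through the quadratic form `v ↦ D²f(x)(v, v)` of the Hessian. -/
structure IsStronglyConvexSmooth {d : ℕ} (f : EuclideanSpace ℝ (Fin d) → ℝ) (α β : ℝ) : Prop where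
  contDiff : ContDiff ℝ 2 f
  pos : 0 < α
  le : α ≤ β
  hess_lower : ∀ x v : EuclideanSpace ℝ (Fin d), α * ‖v‖ ^ 2 ≤ fderiv ℝ (fderiv ℝ f) x v v
  hess_upper : ∀ x v : EuclideanSpace ℝ (Fin d), fderiv ℝ (fderiv ℝ f) x v v ≤ β * ‖v‖ ^ 2

/-- The unadjusted Langevin iterates with step size `η`, initial value `X₀` and noise `Z`:
`X_{i+1} = X_i - η ∇f(X_i) + √(2η) Z_{i+1}`. The noise of the first step is `Z 0`, that of step
`i + 1` is `Z i`. -/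
def iterate {d : ℕ} {Ω : Type*} (f : EuclideanSpace ℝ (Fin d) → ℝ) (η : ℝ)
    (X₀ : Ω → EuclideanSpace ℝ (Fin d)) (Z : ℕ → Ω → EuclideanSpace ℝ (Fin d)) :
    ℕ → Ω → EuclideanSpace ℝ (Fin d)
  | 0 => X₀
  | i + 1 => fun ω => iterate f η X₀ Z i ω - η • gradient f (iterate f η X₀ Z i ω)
      + √(2 * η) • Z i ω

/-- The sample mean of `x_{m+1}, …, x_{m+n}`. -/
def sampleMean {d : ℕ} (m n : ℕ) (x : ℕ → EuclideanSpace ℝ (Fin d)) : EuclideanSpace ℝ (Fin d) :=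
  (1 / (n : ℝ)) • ∑ i ∈ Finset.Icc (m + 1) (m + n), x i

/-- The sample covariance matrix of `x_{m+1}, …, x_{m+n}`:
`(1/n) ∑ x_i x_iᵀ - x̄ x̄ᵀ`. -/
def sampleCov {d : ℕ} (m n : ℕ) (x : ℕ → EuclideanSpace ℝ (Fin d)) : Matrix (Fin d) (Fin d) ℝ :=
  (1 / (n : ℝ)) • ∑ i ∈ Finset.Icc (m + 1) (m + n), Matrix.vecMulVec (x i) (x i)
    - Matrix.vecMulVec (sampleMean m n x) (sampleMean m n x)

/-- The sample covariance matrix of the iterates `X_{m+1}, …, X_{m+n}`, as a random matrix. -/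
def iterateCov {d : ℕ} {Ω : Type*} (f : EuclideanSpace ℝ (Fin d) → ℝ) (η : ℝ)
    (X₀ : Ω → EuclideanSpace ℝ (Fin d)) (Z : ℕ → Ω → EuclideanSpace ℝ (Fin d)) (m n : ℕ) :
    Ω → Matrix (Fin d) (Fin d) ℝ :=
  fun ω => sampleCov m n fun i => iterate f η X₀ Z i ω

/-- The entrywise expectation of a random matrix. -/
def expect {d : ℕ} {Ω : Type*} [MeasurableSpace Ω] (P : Measure Ω)
    (A : Ω → Matrix (Fin d) (Fin d) ℝ) : Matrix (Fin d) (Fin d) ℝ :=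
  Matrix.of fun j k => ∫ ω, A ω j k ∂P

/-- The operator norm of a matrix with respect to the Euclidean norm. -/
def opNorm {d : ℕ} (A : Matrix (Fin d) (Fin d) ℝ) : ℝ :=
  ‖Matrix.toEuclideanCLM (𝕜 := ℝ) A‖

/-- The deviation `‖A - E A‖` (operator norm) of a random matrix from its expectation. -/
def deviation {d : ℕ} {Ω : Type*} [MeasurableSpace Ω] (P : Measure Ω)
    (A : Ω → Matrix (Fin d) (Fin d) ℝ) (ω : Ω) : ℝ :=
  opNorm (A ω - expect P A)

/-- The lower bound on the burn-in length, with `s = E|X₀ - x⋆|²`: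
`0 ∨ (log(κ₀/η) / log(1/(1-αη)) - 1) ∨ (log(4(s + d/α)/(ηn)) / log(1/(1-αη)) - 1)`.
The convention `log 0 = -∞` makes a term with a vanishing argument drop out of the maximum. So does
`Real.log 0 = 0`, which turns this term into `-1`. -/
def burnIn (d n : ℕ) (α η κ₀ s : ℝ) : ℝ :=
  max (max 0 (Real.log (κ₀ / η) / Real.log (1 / (1 - α * η)) - 1))
    (Real.log (4 * (s + d / α) / (η * n)) / Real.log (1 / (1 - α * η)) - 1)

end ULA

end

/-! For `‖u‖ ≤ 1`, the quadratic form of the sample covariance at `u` is `H² / n`, where `H` is the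
Euclidean norm of the centred vector of the projections `⟨X_i, u⟩`. A norm is Lipschitz where its
square is not, so the proof concentrates `H` first and passes to `H²` afterwards.

The gradient step contracts with factor `ρ = 1 - αη`. Hence `H` is Lipschitz in `X₀` with squared
constant `∑ ρ^(2i)` and in the whole Gaussian noise vector with squared constant `2η / (αη)²`,
whatever the number of steps (`sum_norm_noisyIterate_sub_sq_le`). Lipschitz functions of `X₀` are
sub-Gaussian by Herbst's argument (`ULA.LSI.lipSubgaussian`), those of the noise by Maurey–Pisier
(`lipSubgaussian_stdGaussian`), and variance proxies add over independent blocks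
(`LipSubgaussian.prod`). The first burn-in condition makes the contribution of `X₀` at most `1 /
(α²η)`, so `H` has proxy `6 / (α²η)`.

Passing to `H²` requires `E H² ≤ 13 n / α` (`IsGaussianNoise.integral_norm_centred_sq_le`): each
projection has variance at most `12 / α`, and the drift of the means adds at most `n / α` in total.
A coupling by shifted noise and the second burn-in condition control the drift.

A `1/4`-net of the unit ball with at most `9 ^ d` points turns the bound for each `u` into an
operator norm bound, at the price of a factor 2 in the deviation. With tail parameter `x = (9d + 4
log δ⁻¹) / 4` the union bound costs nothing in `d`, because `9 ≤ exp (9/4)`; the total failure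
probability is at most `2δ`. -/

set_option linter.unusedSectionVars false

/-! ### Sub-Gaussian concentration of Lipschitz functions: reduction to smooth bounded ones. -/

section LipschitzConcentration

open Filter Topology
open scoped NNReal ENNReal ContDiff

variable {E : Type*} [NormedAddCommGroup E] [InnerProductSpace ℝ E] [FiniteDimensional ℝ E]
  [MeasurableSpace E] [BorelSpace E]

/-- A Lipschitz function on a finite-dimensional space is a uniform limit of smooth functions with
the same Lipschitz constant. -/
theorem LipschitzWith.exists_contDiff_approx {L : ℝ≥0} {h : E → ℝ} (hh : LipschitzWith L h)
    {ε : ℝ} (hε : 0 < ε) :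
    ∃ φ : E → ℝ, ContDiff ℝ ∞ φ ∧ LipschitzWith L φ ∧ ∀ x, |φ x - h x| ≤ ε := by
  obtain ⟨δ, hδ, hLδ⟩ : ∃ δ > 0, L * δ ≤ ε := by
    refine ⟨ε / (L + 1), by positivity, ?_⟩
    rw [mul_div_assoc', div_le_iff₀ (by positivity)]
    nlinarith [L.coe_nonneg]
  let b : ContDiffBump (0 : E) := ⟨δ / 2, δ, by positivity, by linarith⟩
  let μ : Measure E := MeasureTheory.volume
  have hint : ∀ x, Integrable (fun t => b.normed μ t • h (x - t)) μ := by
    intro x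
    apply Continuous.integrable_of_hasCompactSupport
    · exact (b.continuous_normed).smul (hh.continuous.comp (by fun_prop))
    · exact (b.hasCompactSupport_normed).smul_right
  refine ⟨convolution (b.normed μ) h (ContinuousLinearMap.lsmul ℝ ℝ) μ, ?_, ?_, ?_⟩
  · exact b.hasCompactSupport_normed.contDiff_convolution_left _ b.contDiff_normed
      hh.continuous.locallyIntegrable
  · refine LipschitzWith.of_dist_le_mul fun x y => ?_
    rw [Real.dist_eq]
    simp only [convolution_def, ContinuousLinearMap.lsmul_apply]
    rw [← integral_sub (hint x) (hint y)]
    calc |∫ t, (b.normed μ t • h (x - t) - b.normed μ t • h (y - t)) ∂μ|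
        ≤ ∫ t, b.normed μ t * (L * dist x y) ∂μ := by
          rw [← Real.norm_eq_abs]
          refine norm_integral_le_of_norm_le (b.integrable_normed.mul_const _)
            (Eventually.of_forall fun t => ?_)
          rw [← smul_sub, norm_smul, Real.norm_of_nonneg (b.nonneg_normed t), ← dist_eq_norm]
          gcongr
          · exact b.nonneg_normed t
          · have := hh.dist_le_mul (x - t) (y - t)
            rwa [dist_sub_right] at this
      _ = L * dist x y := by
          rw [integral_mul_const, b.integral_normed, one_mul]
  · intro x
    rw [← Real.dist_eq]
    refine b.dist_normed_convolution_le hh.continuous.aestronglyMeasurable fun y hy => ?_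
    refine (hh.dist_le_mul y x).trans (le_trans ?_ hLδ)
    gcongr
    exact (Metric.mem_ball.1 hy).le

/-- Every `L`-Lipschitz function is, once centred, sub-Gaussian with variance proxy `K L²`. -/
def LipSubgaussian (μ : Measure E) (K : ℝ≥0) : Prop :=
  ∀ (L : ℝ≥0) (h : E → ℝ), LipschitzWith L h →
    HasSubgaussianMGF (fun x => h x - ∫ y, h y ∂μ) (K * L ^ 2) μ

variable {μ : Measure E} [IsProbabilityMeasure μ] {K : ℝ≥0}

theorem integrable_of_continuous_of_bounded {h : E → ℝ} (hc : Continuous h) {B : ℝ}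
    (hB : ∀ x, |h x| ≤ B) : Integrable h μ :=
  .of_bound hc.aestronglyMeasurable B (Eventually.of_forall hB)

theorem integrable_exp_of_continuous_of_bounded {h : E → ℝ} (hc : Continuous h) {B : ℝ}
    (hB : ∀ x, |h x| ≤ B) : Integrable (fun x => Real.exp (h x)) μ :=
  integrable_of_continuous_of_bounded (B := Real.exp B) (by fun_prop) fun x => by
    rw [Real.abs_exp]; exact Real.exp_le_exp.2 ((le_abs_self _).trans (hB x))

/-- Mollification within `ε` changes each side by a factor of at most `exp ε` and keeps the
Lipschitz constant, so smoothness can be dropped by letting `ε → 0`. -/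
theorem integral_exp_le_of_smooth
    (H : ∀ (L : ℝ≥0) (h : E → ℝ) (B : ℝ), ContDiff ℝ ∞ h → LipschitzWith L h → (∀ x, |h x| ≤ B) →
      ∫ x, Real.exp (h x) ∂μ ≤ Real.exp (∫ x, h x ∂μ + K * L ^ 2 / 2))
    {L : ℝ≥0} {h : E → ℝ} {B : ℝ} (hh : LipschitzWith L h) (hB : ∀ x, |h x| ≤ B) :
    ∫ x, Real.exp (h x) ∂μ ≤ Real.exp (∫ x, h x ∂μ + K * L ^ 2 / 2) := by
  have key : ∀ ε : ℝ, 0 < ε →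
      ∫ x, Real.exp (h x) ∂μ ≤ Real.exp (∫ x, h x ∂μ + K * L ^ 2 / 2 + 2 * ε) := by
    intro ε hε
    obtain ⟨φ, hφ, hφL, hφh⟩ := hh.exists_contDiff_approx hε
    have hφB : ∀ x, |φ x| ≤ B + ε := fun x => by
      have := abs_sub_abs_le_abs_sub (φ x) (h x)
      linarith [hφh x, hB x]
    have h1 := H L φ (B + ε) hφ hφL hφB
    have h2 : ∫ x, φ x ∂μ ≤ ∫ x, h x ∂μ + ε := by
      have : ∫ x, φ x ∂μ ≤ ∫ x, (h x + ε) ∂μ :=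
        integral_mono (integrable_of_continuous_of_bounded hφL.continuous hφB)
          ((integrable_of_continuous_of_bounded hh.continuous hB).add (integrable_const _))
          fun x => by have := (abs_le.1 (hφh x)).2; simp only; linarith
      rwa [integral_add (integrable_of_continuous_of_bounded hh.continuous hB)
        (integrable_const _), integral_const, probReal_univ, one_smul] at this
    calc ∫ x, Real.exp (h x) ∂μ ≤ ∫ x, Real.exp ε * Real.exp (φ x) ∂μ := by
          refine integral_mono (integrable_exp_of_continuous_of_bounded hh.continuous hB)
            ((integrable_exp_of_continuous_of_bounded hφL.continuous hφB).const_mul _) fun x => ?_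
          simp only
          rw [← Real.exp_add]
          have := (abs_le.1 (hφh x)).1
          exact Real.exp_le_exp.2 (by linarith)
      _ = Real.exp ε * ∫ x, Real.exp (φ x) ∂μ := integral_const_mul _ _
      _ ≤ Real.exp ε * Real.exp (∫ x, φ x ∂μ + K * L ^ 2 / 2) := by gcongr
      _ ≤ _ := by
          rw [← Real.exp_add]
          exact Real.exp_le_exp.2 (by linarith)
  have lim : Tendsto (fun ε : ℝ => Real.exp (∫ x, h x ∂μ + K * L ^ 2 / 2 + 2 * ε)) (𝓝[>] 0)
      (𝓝 (Real.exp (∫ x, h x ∂μ + K * L ^ 2 / 2 + 2 * 0))) :=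
    ((by fun_prop : Continuous fun ε : ℝ =>
      Real.exp (∫ x, h x ∂μ + K * L ^ 2 / 2 + 2 * ε)).tendsto 0).mono_left nhdsWithin_le_nhds
  rw [mul_zero, add_zero] at lim
  exact ge_of_tendsto lim (eventually_mem_nhdsWithin.mono fun ε hε => key ε hε)

/-- Fatou's lemma along the truncations, which are eventually constant at each point. -/
theorem integrable_exp_of_truncation {g : E → ℝ} (hg : Continuous g) {C : ℝ}
    (hC : ∀ N : ℕ, ∫ x, Real.exp (min (g x) N) ∂μ ≤ C) :
    Integrable (fun x => Real.exp (g x)) μ := by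
  have hGf : ∀ x, Tendsto (fun N : ℕ => Real.exp (min (g x) N)) atTop (𝓝 (Real.exp (g x))) := by
    intro x
    obtain ⟨M, hM⟩ := exists_nat_ge (g x)
    refine tendsto_const_nhds.congr' ((eventually_ge_atTop M).mono fun N hN => ?_)
    have : g x ≤ N := hM.trans (by exact_mod_cast hN)
    simp only [min_eq_left this]
  refine ⟨(Real.continuous_exp.comp hg).aestronglyMeasurable, ?_⟩
  refine lt_of_le_of_lt (b := ENNReal.ofReal C) ?_ ENNReal.ofReal_lt_top
  calc ∫⁻ x, ‖Real.exp (g x)‖ₑ ∂μ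
      = ∫⁻ x, liminf (fun N : ℕ => ‖Real.exp (min (g x) N)‖ₑ) atTop ∂μ :=
        lintegral_congr fun x => ((hGf x).enorm.liminf_eq).symm
    _ ≤ liminf (fun N : ℕ => ∫⁻ x, ‖Real.exp (min (g x) N)‖ₑ ∂μ) atTop :=
        lintegral_liminf_le' fun N =>
          (by fun_prop : Continuous fun x => Real.exp (min (g x) N)).aemeasurable.enorm
    _ ≤ ENNReal.ofReal C := ?_
  · refine liminf_le_of_le (by isBoundedDefault) fun b hb => ?_
    obtain ⟨N, hN⟩ := hb.exists
    refine hN.trans ?_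
    have : Integrable (fun x => Real.exp (min (g x) N)) μ :=
      .of_bound (by fun_prop : Continuous fun x => Real.exp (min (g x) N)).aestronglyMeasurable
        (Real.exp N) (Eventually.of_forall fun x => by
          rw [Real.norm_eq_abs, Real.abs_exp]; exact Real.exp_le_exp.2 (min_le_right _ _))
    rw [← ofReal_integral_norm_eq_lintegral_enorm this]
    simp only [Real.norm_eq_abs, Real.abs_exp]
    exact ENNReal.ofReal_le_ofReal (hC N)

/-- No integrability of unbounded Lipschitz functions is assumed. It is extracted from the
inequality for bounded functions, and then dominated convergence removes the truncation. -/
theorem LipSubgaussian.of_smooth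
    (H : ∀ (L : ℝ≥0) (h : E → ℝ) (B : ℝ), ContDiff ℝ ∞ h → LipschitzWith L h → (∀ x, |h x| ≤ B) →
      ∫ x, Real.exp (h x) ∂μ ≤ Real.exp (∫ x, h x ∂μ + K * L ^ 2 / 2)) :
    LipSubgaussian μ K := by
  have hexp : ∀ (L : ℝ≥0) (g : E → ℝ), LipschitzWith L g → (∀ x, 0 ≤ g x) →
      Integrable (fun x => Real.exp (g x)) μ := by
    intro L g hg hg0
    have hgc := hg.continuous
    have hi : Integrable (fun x => Real.exp (-g x)) μ :=
      .of_bound (by fun_prop : Continuous fun x => Real.exp (-g x)).aestronglyMeasurable 1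
        (Eventually.of_forall fun x => by
          rw [Real.norm_eq_abs, Real.abs_exp]; exact Real.exp_le_one_iff.2 (by linarith [hg0 x]))
    set p := ∫ x, Real.exp (-g x) ∂μ
    have hp : 0 < p := integral_exp_pos hi
    refine integrable_exp_of_truncation hg.continuous
      (C := Real.exp (K * L ^ 2 / 2) / p * Real.exp (K * L ^ 2 / 2)) fun N => ?_
    have hgN : LipschitzWith L fun x => min (g x) (N : ℝ) := hg.min_const _
    have hB : ∀ x, |min (g x) (N : ℝ)| ≤ N := fun x => by
      rw [abs_of_nonneg (le_min (hg0 x) N.cast_nonneg)]; exact min_le_right _ _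
    have hB' : ∀ x, |-min (g x) (N : ℝ)| ≤ N := fun x => by rw [abs_neg]; exact hB x
    have h1 := integral_exp_le_of_smooth H hgN hB
    have h2 := integral_exp_le_of_smooth H hgN.neg hB'
    have h3 : p ≤ ∫ x, Real.exp (-min (g x) (N : ℝ)) ∂μ :=
      integral_mono hi (integrable_exp_of_continuous_of_bounded hgN.neg.continuous hB')
        fun x => Real.exp_le_exp.2 (neg_le_neg (min_le_left _ _))
    -- The inequality for the negated truncation bounds the truncated means uniformly in `N`: a
    -- large mean would force `∫ exp (-min g N)` below the fixed positive number `p`.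
    have h4 : Real.exp (∫ x, min (g x) (N : ℝ) ∂μ) ≤ Real.exp (K * L ^ 2 / 2) / p := by
      rw [le_div_iff₀ hp]
      have h5 := h3.trans h2
      simp only [Pi.neg_apply] at h5
      rw [integral_neg] at h5
      calc _ ≤ Real.exp (∫ x, min (g x) (N : ℝ) ∂μ) *
            Real.exp (-(∫ x, min (g x) (N : ℝ) ∂μ) + K * L ^ 2 / 2) := by gcongr
        _ = _ := by rw [← Real.exp_add]; ring_nf
    refine h1.trans ?_
    rw [Real.exp_add]
    gcongr
  have main : ∀ (L : ℝ≥0) (h : E → ℝ), LipschitzWith L h →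
      Integrable (fun x => Real.exp (h x)) μ ∧ Integrable h μ ∧
      ∫ x, Real.exp (h x) ∂μ ≤ Real.exp (∫ x, h x ∂μ + K * L ^ 2 / 2) := by
    intro L h hh
    have hhc := hh.continuous
    have habs : LipschitzWith L fun x => |h x| := by
      simpa using! (LipschitzWith.comp (lipschitzWith_one_norm (E := ℝ)) hh)
    have hei := hexp L _ habs fun x => abs_nonneg _
    have hai : Integrable h μ := hei.mono' hhc.aestronglyMeasurable
      (Eventually.of_forall fun x => by
        rw [Real.norm_eq_abs]; linarith [Real.add_one_le_exp |h x|])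
    have heh : Integrable (fun x => Real.exp (h x)) μ :=
      hei.mono' (by fun_prop : Continuous fun x => Real.exp (h x)).aestronglyMeasurable
      (Eventually.of_forall fun x => by
        rw [Real.norm_eq_abs, Real.abs_exp]; exact Real.exp_le_exp.2 (le_abs_self _))
    refine ⟨heh, hai, ?_⟩
    let T : ℕ → E → ℝ := fun N x => max (min (h x) N) (-N)
    have hTL : ∀ N, LipschitzWith L (T N) := fun N => (hh.min_const _).max_const _
    have hTc : ∀ N, Continuous (T N) := fun N => (hTL N).continuous
    have hTB : ∀ N x, |T N x| ≤ N := fun N x => by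
      refine abs_le.2 ⟨le_max_right _ _, max_le (min_le_right _ _) ?_⟩
      linarith [(Nat.cast_nonneg N : (0 : ℝ) ≤ N)]
    have hTh : ∀ N x, |T N x| ≤ |h x| := fun N x => by
      have hN : (0 : ℝ) ≤ N := N.cast_nonneg
      simp only [T]
      rcases le_total (h x) N with h1 | h1
      · rw [min_eq_left h1]
        rcases le_total (h x) (-N) with h2 | h2
        · rw [max_eq_right h2, abs_of_nonpos (by linarith), abs_of_nonpos (by linarith)]; linarith
        · rw [max_eq_left h2]
      · rw [min_eq_right h1, max_eq_left (by linarith), abs_of_nonneg hN,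
          abs_of_nonneg (by linarith)]; exact h1
    have hTt : ∀ x, Tendsto (fun N => T N x) atTop (𝓝 (h x)) := fun x => by
      obtain ⟨M, hM⟩ := exists_nat_ge |h x|
      refine tendsto_const_nhds.congr' ((eventually_ge_atTop M).mono fun N hN => ?_)
      have : |h x| ≤ N := hM.trans (by exact_mod_cast hN)
      simp only [T]
      rw [min_eq_left (abs_le.1 this).2, max_eq_left (abs_le.1 this).1]
    have lim1 : Tendsto (fun N => ∫ x, T N x ∂μ) atTop (𝓝 (∫ x, h x ∂μ)) :=
      tendsto_integral_of_dominated_convergence (fun x => |h x|)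
        (fun N => (hTc N).aestronglyMeasurable) hai.abs
        (fun N => Eventually.of_forall (hTh N)) (Eventually.of_forall hTt)
    have lim2 : Tendsto (fun N => ∫ x, Real.exp (T N x) ∂μ) atTop
        (𝓝 (∫ x, Real.exp (h x) ∂μ)) :=
      tendsto_integral_of_dominated_convergence (fun x => Real.exp |h x|)
        (fun N => (Real.continuous_exp.comp (hTc N)).aestronglyMeasurable) hei
        (fun N => Eventually.of_forall fun x => by
          rw [Real.norm_eq_abs, Real.abs_exp]
          exact Real.exp_le_exp.2 ((le_abs_self _).trans (hTh N x)))
        (Eventually.of_forall fun x => (Real.continuous_exp.tendsto _).comp (hTt x))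
    exact le_of_tendsto_of_tendsto' lim2
      ((Real.continuous_exp.tendsto _).comp (lim1.add_const _))
      fun N => integral_exp_le_of_smooth H (hTL N) (hTB N)
  intro L h hh
  have hs : ∀ t : ℝ, LipschitzWith (‖t‖₊ * L) fun x => t * h x := fun t =>
    (lipschitzWith_smul t).comp hh
  have hfac : ∀ t x, Real.exp (t * (h x - ∫ y, h y ∂μ)) =
      Real.exp (t * h x) * Real.exp (-(t * ∫ y, h y ∂μ)) := fun t x => by
    rw [← Real.exp_add]; ring_nf
  refine ⟨fun t => ?_, fun t => ?_⟩
  · simp only [hfac]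
    exact (main _ _ (hs t)).1.mul_const _
  · simp only [mgf, hfac]
    rw [integral_mul_const]
    refine (mul_le_mul_of_nonneg_right (main _ _ (hs t)).2.2 (Real.exp_nonneg _)).trans ?_
    rw [← Real.exp_add, integral_const_mul]
    refine Real.exp_le_exp.2 (le_of_eq ?_)
    push_cast
    rw [mul_pow, Real.norm_eq_abs, sq_abs]
    ring

theorem LipSubgaussian.integrable (hμ : LipSubgaussian μ K) {L : ℝ≥0} {h : E → ℝ}
    (hh : LipschitzWith L h) : Integrable h μ := by
  simpa [Pi.add_def] using! (hμ L h hh).integrable.add (integrable_const (∫ y, h y ∂μ))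

theorem LipSubgaussian.integrable_norm_sub_sq (hμ : LipSubgaussian μ K) (a : E) :
    Integrable (fun x => ‖x - a‖ ^ 2) μ := by
  have hl : LipschitzWith 1 fun x : E => ‖x - a‖ := by
    simpa [dist_eq_norm] using! (LipschitzWith.dist_left a : LipschitzWith 1 fun x => dist x a)
  have h2 := ((hμ 1 _ hl).memLp 2).add (memLp_const (∫ y, ‖y - a‖ ∂μ))
  simpa [Pi.add_def] using! h2.integrable_sq

end LipschitzConcentration

/-! ### From the log-Sobolev inequality to concentration. -/

section Herbst

open Filter Topology
open scoped NNReal ENNReal ContDiff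

variable {d : ℕ} {ν : Measure (EuclideanSpace ℝ (Fin d))} [IsProbabilityMeasure ν] {C : ℝ}

/-- The log-Sobolev inequality is tested on `exp (t φ / 2)`, whose squared gradient is at most `t²
L² / 4` times `exp (t φ)`; the left side becomes the entropy of `exp (t φ)`. -/
theorem ULA.LSI.entropy_exp_le (hν : ULA.LSI ν C) {φ : EuclideanSpace ℝ (Fin d) → ℝ} {L : ℝ≥0}
    {B : ℝ} (hφ : ContDiff ℝ ∞ φ) (hL : LipschitzWith L φ) (hB : ∀ x, |φ x| ≤ B) (t : ℝ) :
    t * (∫ x, φ x * Real.exp (t * φ x) ∂ν) - mgf φ ν t * cgf φ ν t ≤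
      C * L ^ 2 / 2 * t ^ 2 * mgf φ ν t := by
  have hφc := hφ.continuous
  set g : EuclideanSpace ℝ (Fin d) → ℝ := fun x => Real.exp (t / 2 * φ x) with hg
  have hgs : ContDiff ℝ ∞ g := (contDiff_const.mul hφ).exp
  have hgsq : ∀ x, g x ^ 2 = Real.exp (t * φ x) := fun x => by
    rw [hg, ← Real.exp_nat_mul]; congr 1; push_cast; ring
  have hbd : ∀ (s : ℝ) x, |s * φ x| ≤ |s| * B := fun s x => by
    rw [abs_mul]; exact mul_le_mul_of_nonneg_left (hB x) (abs_nonneg _)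
  have hei : Integrable (fun x => Real.exp (t * φ x)) ν :=
    integrable_exp_of_continuous_of_bounded (by fun_prop) (hbd t)
  have hB0 : 0 ≤ B := (abs_nonneg _).trans (hB 0)
  have hgrad : ∀ x, ‖gradient g x‖ ^ 2 ≤ t ^ 2 / 4 * L ^ 2 * Real.exp (t * φ x) := by
    intro x
    have hd : HasFDerivAt g (Real.exp (t / 2 * φ x) • ((t / 2) • fderiv ℝ φ x)) x :=
      (((hφ.differentiable (by simp)) x).hasFDerivAt.const_mul (t / 2)).exp
    have : ‖gradient g x‖ = Real.exp (t / 2 * φ x) * (|t / 2| * ‖fderiv ℝ φ x‖) := by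
      rw [gradient, LinearIsometryEquiv.norm_map, hd.fderiv, norm_smul, norm_smul,
        Real.norm_eq_abs, Real.norm_eq_abs, Real.abs_exp]
    rw [this, ← hgsq]
    have hn : ‖fderiv ℝ φ x‖ ≤ L := norm_fderiv_le_of_lipschitz ℝ hL
    have h2 : ‖fderiv ℝ φ x‖ ^ 2 ≤ (L : ℝ) ^ 2 := by gcongr
    rw [mul_pow, mul_pow, sq_abs]
    calc g x ^ 2 * ((t / 2) ^ 2 * ‖fderiv ℝ φ x‖ ^ 2)
        ≤ g x ^ 2 * ((t / 2) ^ 2 * (L : ℝ) ^ 2) := by gcongr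
      _ = _ := by ring
  have hgc : Continuous fun x => gradient g x :=
    (InnerProductSpace.toDual ℝ _).symm.continuous.comp (hgs.continuous_fderiv (by simp))
  have hgi : Integrable (fun x => ‖gradient g x‖ ^ 2) ν := by
    refine (hei.const_mul (t ^ 2 / 4 * L ^ 2)).mono' (by fun_prop) (Eventually.of_forall fun x => ?_)
    rw [Real.norm_of_nonneg (by positivity)]
    exact hgrad x
  have hli : Integrable (fun x => g x ^ 2 * |Real.log (g x)|) ν := by
    simp only [hgsq]
    simp only [hg, Real.log_exp]
    refine (hei.mul_const (|t / 2| * B)).mono' (by fun_prop) (Eventually.of_forall fun x => ?_)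
    rw [Real.norm_of_nonneg (by positivity)]
    exact mul_le_mul_of_nonneg_left (hbd _ x) (Real.exp_nonneg _)
  have h := hν.2 g hgs hli hgi
  have h1 : ∫ x, g x ^ 2 * Real.log (g x ^ 2) ∂ν = t * ∫ x, φ x * Real.exp (t * φ x) ∂ν := by
    rw [← integral_const_mul]
    refine integral_congr_ae (Eventually.of_forall fun x => ?_)
    simp only [hgsq, Real.log_exp]; ring
  have h2 : ∫ x, g x ^ 2 ∂ν = mgf φ ν t := by simp only [hgsq, mgf]
  rw [h1, h2] at h
  have h3 : ∫ x, ‖gradient g x‖ ^ 2 ∂ν ≤ t ^ 2 / 4 * L ^ 2 * mgf φ ν t := by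
    rw [mgf, ← integral_const_mul]
    exact integral_mono hgi (hei.const_mul _) hgrad
  have h4 := mul_le_mul_of_nonneg_left h3 (mul_nonneg zero_le_two hν.1)
  rw [cgf]
  linarith

/-- **Herbst's argument**: a log-Sobolev inequality implies sub-Gaussian concentration. -/
theorem ULA.LSI.lipSubgaussian (hν : ULA.LSI ν C) : LipSubgaussian ν ⟨C, hν.1⟩ := by
  refine LipSubgaussian.of_smooth fun L φ B hφ hL hB => ?_
  have hφc := hφ.continuous
  have hei : ∀ t, Integrable (fun x => Real.exp (t * φ x)) ν := fun t =>
    integrable_exp_of_continuous_of_bounded (B := |t| * B) (by fun_prop) fun x => by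
      rw [abs_mul]; exact mul_le_mul_of_nonneg_left (hB x) (abs_nonneg _)
  have hset : ∀ t, t ∈ interior (integrableExpSet φ ν) := fun t => by
    have : integrableExpSet φ ν = Set.univ := Set.eq_univ_of_forall hei
    simp [this]
  have hpos : ∀ t, 0 < mgf φ ν t := fun t => mgf_pos (hei t)
  have hder : ∀ t, HasDerivAt (cgf φ ν) ((∫ x, φ x * Real.exp (t * φ x) ∂ν) / mgf φ ν t) t :=
    fun t => (hasDerivAt_mgf (hset t)).log (hpos t).ne'
  set A : ℝ := C * L ^ 2 / 2
  -- The entropy bound divided by `t²` times the moment generating function says exactly that `ψ' ≤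
  -- 0`. Since `ψ` tends to the mean at `0+`, the value `ψ 1` gives the claim.
  set ψ : ℝ → ℝ := fun t => cgf φ ν t / t - A * t
  have hψ : ∀ t, 0 < t → HasDerivAt ψ
      (((∫ x, φ x * Real.exp (t * φ x) ∂ν) / mgf φ ν t * t - cgf φ ν t * 1) / t ^ 2 - A * 1) t :=
    fun t ht => ((hder t).div (hasDerivAt_id t) ht.ne').sub ((hasDerivAt_id t).const_mul A)
  have hanti : AntitoneOn ψ (Set.Ioi 0) := by
    refine antitoneOn_of_deriv_nonpos (convex_Ioi 0)
      (fun t ht => (hψ t ht).continuousAt.continuousWithinAt)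
      (fun t ht => (hψ t (interior_subset ht)).differentiableAt.differentiableWithinAt)
      fun t ht => ?_
    have ht : 0 < t := interior_subset ht
    rw [(hψ t ht).deriv, sub_nonpos, mul_one, mul_one, div_le_iff₀ (by positivity),
      ← mul_le_mul_iff_left₀ (hpos t), sub_mul]
    have h5 : t * (∫ x, φ x * Real.exp (t * φ x) ∂ν) - mgf φ ν t * cgf φ ν t ≤
        A * t ^ 2 * mgf φ ν t := hν.entropy_exp_le hφ hL hB t
    rw [mul_right_comm, div_mul_cancel₀ _ (hpos t).ne']
    linarith
  have hlim : Tendsto ψ (𝓝[>] 0) (𝓝 (∫ x, φ x ∂ν)) := by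
    have h0 := (hasDerivAt_iff_tendsto_slope.1 (hder 0)).mono_left
      (nhdsWithin_mono 0 (fun x (hx : 0 < x) => hx.ne') : 𝓝[>] (0 : ℝ) ≤ 𝓝[≠] 0)
    have h1 : Tendsto (fun t : ℝ => A * t) (𝓝[>] 0) (𝓝 (A * 0)) :=
      ((continuous_const_mul A).tendsto 0).mono_left nhdsWithin_le_nhds
    have h2 := h0.sub h1
    simp only [zero_mul, Real.exp_zero, mul_one, mgf_zero, div_one, mul_zero, sub_zero] at h2
    refine h2.congr fun t => ?_
    simp [ψ, slope_def_field, cgf_zero]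
  have hle : ψ 1 ≤ ∫ x, φ x ∂ν := by
    refine ge_of_tendsto hlim ?_
    filter_upwards [Ioo_mem_nhdsGT (zero_lt_one (α := ℝ))] with t ht
    exact hanti ht.1 (Set.mem_Ioi.2 zero_lt_one) ht.2.le
  have hm : ∫ x, Real.exp (φ x) ∂ν = mgf φ ν 1 := by simp [mgf]
  rw [hm, ← Real.exp_log (hpos 1)]
  refine Real.exp_le_exp.2 ?_
  have : ψ 1 = Real.log (mgf φ ν 1) - A := by simp [ψ, cgf]
  change _ ≤ _ + A
  linarith

end Herbst

/-! ### Gaussian concentration by rotation. -/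

section Gaussian

open Filter Topology
open scoped NNReal ENNReal ContDiff

variable {W : Type*} [NormedAddCommGroup W] [InnerProductSpace ℝ W] [FiniteDimensional ℝ W]
  [MeasurableSpace W] [BorelSpace W]

theorem lintegral_exp_dual_stdGaussian (ℓ : StrongDual ℝ W) :
    ∫⁻ v, ENNReal.ofReal (Real.exp (ℓ v)) ∂(stdGaussian W) =
      ENNReal.ofReal (Real.exp (‖ℓ‖ ^ 2 / 2)) := by
  have hmap := IsGaussian.map_eq_gaussianReal (μ := stdGaussian W) ℓ
  rw [integral_strongDual_stdGaussian, variance_dual_stdGaussian] at hmap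
  have hmgf := mgf_gaussianReal hmap 1
  have hint : Integrable (fun v => Real.exp (1 * ℓ v)) (stdGaussian W) := by
    rw [← mgf_pos_iff, hmgf]; exact Real.exp_pos _
  simp only [one_mul] at hint
  rw [← ofReal_integral_eq_lintegral_ofReal hint (Eventually.of_forall fun _ => Real.exp_nonneg _)]
  simp only [mgf, one_mul] at hmgf
  rw [hmgf]
  congr 2
  simp

/-- The quarter circle `u` joins `p.1` to `p.2` and has velocity `(π/2) v`, where `(u, v)` is a
rotation of `p`. Writing the difference as an integral along it and applying Jensen's inequality in
`s` gives the bound. -/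
theorem exp_sub_le_lintegral_rotation {φ : W → ℝ} (hφ : ContDiff ℝ 1 φ) (p : W × W) :
    ENNReal.ofReal (Real.exp (φ p.2 - φ p.1)) ≤ ∫⁻ s in Set.Ioc (0 : ℝ) 1,
      ENNReal.ofReal (Real.exp ((Real.pi / 2) *
        fderiv ℝ φ (ContinuousLinearMap.rotation (Real.pi / 2 * s) p).1
          (ContinuousLinearMap.rotation (Real.pi / 2 * s) p).2)) := by
  simp only [ContinuousLinearMap.rotation_apply]
  set c : ℝ := Real.pi / 2 with hc
  set u : ℝ → W := fun s => Real.cos (c * s) • p.1 + Real.sin (c * s) • p.2 with hu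
  set v : ℝ → W := fun s => -Real.sin (c * s) • p.1 + Real.cos (c * s) • p.2 with hv
  have hud : ∀ s, HasDerivAt u (c • v s) s := by
    intro s
    have h0 : HasDerivAt (fun s => c * s) c s := by simpa using (hasDerivAt_id s).const_mul c
    have h1 := (h0.cos.smul_const p.1).add (h0.sin.smul_const p.2)
    refine h1.congr_deriv ?_
    simp only [hv, smul_add, smul_smul]
    congr 2 <;> ring
  set k : ℝ → ℝ := fun s => c * fderiv ℝ φ (u s) (v s) with hk
  have hφd : ∀ s, HasDerivAt (fun s => φ (u s)) (k s) s := by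
    intro s
    have := ((hφ.differentiable (by simp)) (u s)).hasFDerivAt.comp_hasDerivAt s (hud s)
    simpa [hk] using! this
  have huc : Continuous u := continuous_iff_continuousAt.2 fun s => (hud s).continuousAt
  have hvc : Continuous v := by fun_prop
  have hkc : Continuous k :=
    continuous_const.mul (((hφ.continuous_fderiv (by simp)).comp huc).clm_apply hvc)
  have hftc : ∫ s in Set.Ioc (0 : ℝ) 1, k s = φ p.2 - φ p.1 := by
    rw [← intervalIntegral.integral_of_le zero_le_one,
      intervalIntegral.integral_eq_sub_of_hasDerivAt (fun s _ => hφd s)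
        (hkc.intervalIntegrable _ _)]
    simp [hu, hc]
  have : IsProbabilityMeasure (volume.restrict (Set.Ioc (0 : ℝ) 1)) := ⟨by simp⟩
  have hki : IntegrableOn k (Set.Ioc 0 1) := (hkc.integrableOn_Icc).mono_set Set.Ioc_subset_Icc_self
  have hei : IntegrableOn (fun s => Real.exp (k s)) (Set.Ioc 0 1) :=
    ((Real.continuous_exp.comp hkc).integrableOn_Icc).mono_set Set.Ioc_subset_Icc_self
  have hJ := convexOn_exp.map_integral_le Real.continuous_exp.continuousOn isClosed_univ
    (Eventually.of_forall fun s => Set.mem_univ (k s)) hki hei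
  rw [hftc] at hJ
  refine (ENNReal.ofReal_le_ofReal hJ).trans (le_of_eq ?_)
  exact ofReal_integral_eq_lintegral_ofReal hei (Eventually.of_forall fun _ => Real.exp_nonneg _)

/-- The **Maurey–Pisier** inequality for Lipschitz functions. -/
theorem lintegral_exp_sub_stdGaussian_le {φ : W → ℝ} {L : ℝ≥0} (hφ : ContDiff ℝ 1 φ)
    (hL : LipschitzWith L φ) :
    ∫⁻ p, ENNReal.ofReal (Real.exp (φ p.2 - φ p.1)) ∂((stdGaussian W).prod (stdGaussian W)) ≤
      ENNReal.ofReal (Real.exp (Real.pi ^ 2 / 4 * L ^ 2 / 2)) := by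
  set γ := stdGaussian W
  have hdc := hφ.continuous_fderiv (by simp)
  let G : W × W → ℝ≥0∞ := fun q => ENNReal.ofReal (Real.exp (Real.pi / 2 * fderiv ℝ φ q.1 q.2))
  have hG : Continuous G := ENNReal.continuous_ofReal.comp (Real.continuous_exp.comp
    (continuous_const.mul ((hdc.comp continuous_fst).clm_apply continuous_snd)))
  have hGle : ∫⁻ q, G q ∂(γ.prod γ) ≤ ENNReal.ofReal (Real.exp (Real.pi ^ 2 / 4 * L ^ 2 / 2)) := by
    rw [lintegral_prod _ hG.aemeasurable]
    calc ∫⁻ x, ∫⁻ y, G (x, y) ∂γ ∂γ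
        ≤ ∫⁻ _, ENNReal.ofReal (Real.exp (Real.pi ^ 2 / 4 * L ^ 2 / 2)) ∂γ := by
          refine lintegral_mono fun x => ?_
          -- For fixed `x` the derivative is a linear form of norm at most `L`, so the inner
          -- integral is an explicit Gaussian one.
          have := lintegral_exp_dual_stdGaussian ((Real.pi / 2) • fderiv ℝ φ x)
          simp only [_root_.smul_apply, smul_eq_mul] at this
          simp only [G]
          rw [this]
          refine ENNReal.ofReal_le_ofReal (Real.exp_le_exp.2 ?_)
          have hn : ‖fderiv ℝ φ x‖ ≤ L := norm_fderiv_le_of_lipschitz ℝ hL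
          rw [norm_smul, mul_pow, Real.norm_eq_abs, sq_abs]
          calc _ = Real.pi ^ 2 / 4 * ‖fderiv ℝ φ x‖ ^ 2 / 2 := by ring
            _ ≤ _ := by gcongr
      _ = _ := by simp
  calc ∫⁻ p, ENNReal.ofReal (Real.exp (φ p.2 - φ p.1)) ∂(γ.prod γ)
      ≤ ∫⁻ p, (∫⁻ s in Set.Ioc (0 : ℝ) 1,
          G (ContinuousLinearMap.rotation (Real.pi / 2 * s) p)) ∂(γ.prod γ) :=
        lintegral_mono fun p => exp_sub_le_lintegral_rotation hφ p
    _ = ∫⁻ s in Set.Ioc (0 : ℝ) 1, (∫⁻ p,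
          G (ContinuousLinearMap.rotation (Real.pi / 2 * s) p) ∂(γ.prod γ)) := by
        refine lintegral_lintegral_swap (Continuous.aemeasurable ?_)
        simp only [Function.uncurry_def, ContinuousLinearMap.rotation_apply]
        exact hG.comp (by fun_prop)
    _ = ∫⁻ s in Set.Ioc (0 : ℝ) 1, ∫⁻ q, G q ∂(γ.prod γ) := by
        refine lintegral_congr fun s => ?_
        -- Two independent standard Gaussians have a rotation-invariant joint law, so the integral
        -- does not depend on `s`.
        have hrot := IsGaussian.map_rotation_eq_self (μ := γ) (by simp [γ]) (Real.pi / 2 * s)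
        conv_rhs => rw [← hrot]
        rw [lintegral_map hG.measurable (ContinuousLinearMap.continuous _).measurable]
    _ = ∫⁻ q, G q ∂(γ.prod γ) := by simp
    _ ≤ _ := hGle

/-- Jensen's inequality replaces the independent copy in the Maurey–Pisier bound by the mean. The
proxy `π² / 4` exceeds the sharp value 1, but it is dimension-free, which is all that matters here.
-/
theorem lipSubgaussian_stdGaussian :
    LipSubgaussian (stdGaussian W) ⟨Real.pi ^ 2 / 4, by positivity⟩ := by
  refine LipSubgaussian.of_smooth fun L φ B hφ hL hB => ?_
  set γ := stdGaussian W
  have hφc := hφ.continuous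
  have hi := integrable_of_continuous_of_bounded (μ := γ) hφc hB
  have hB' : ∀ x, |(-φ x)| ≤ B := fun x => by rw [abs_neg]; exact hB x
  have hp := integrable_exp_of_continuous_of_bounded (μ := γ) hφc hB
  have hn : Integrable (fun x => Real.exp (-φ x)) γ :=
    integrable_exp_of_continuous_of_bounded hφc.neg hB'
  have h1 := lintegral_exp_sub_stdGaussian_le (hφ.of_le (by simp)) hL
  have h2 : ∫⁻ p, ENNReal.ofReal (Real.exp (φ p.2 - φ p.1)) ∂(γ.prod γ) =
      ENNReal.ofReal ((∫ x, Real.exp (-φ x) ∂γ) * ∫ x, Real.exp (φ x) ∂γ) := by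
    have hfac : ∀ p : W × W, Real.exp (φ p.2 - φ p.1) =
        Real.exp (-φ p.1) * Real.exp (φ p.2) := fun p => by rw [← Real.exp_add]; ring_nf
    simp only [hfac]
    rw [← ofReal_integral_eq_lintegral_ofReal (hn.mul_prod hp)
      (Eventually.of_forall fun p => by positivity), integral_prod_mul
        (f := fun x => Real.exp (-φ x)) (g := fun x => Real.exp (φ x))]
  rw [h2, ENNReal.ofReal_le_ofReal_iff (Real.exp_nonneg _)] at h1
  have hJ := convexOn_exp.map_integral_le Real.continuous_exp.continuousOn isClosed_univ
    (Eventually.of_forall fun s => Set.mem_univ (-φ s)) hi.neg hn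
  rw [integral_neg] at hJ
  have h3 : Real.exp (-∫ x, φ x ∂γ) * ∫ x, Real.exp (φ x) ∂γ ≤
      Real.exp (Real.pi ^ 2 / 4 * L ^ 2 / 2) :=
    (mul_le_mul_of_nonneg_right hJ (integral_nonneg fun _ => Real.exp_nonneg _)).trans h1
  rw [Real.exp_neg, inv_mul_le_iff₀ (Real.exp_pos _), ← Real.exp_add] at h3
  exact h3

end Gaussian

/-! ### Sub-Gaussian variables: second moments and independent blocks. -/

section SubgaussianTools

open Filter Topology
open scoped NNReal ENNReal

theorem ProbabilityTheory.HasSubgaussianMGF.lintegral_exp_mul_le {Ω : Type*} [MeasurableSpace Ω]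
    {μ : Measure Ω} {X : Ω → ℝ} {c : ℝ≥0} (h : HasSubgaussianMGF X c μ) (t : ℝ) :
    ∫⁻ ω, ENNReal.ofReal (Real.exp (t * X ω)) ∂μ ≤ ENNReal.ofReal (Real.exp (c * t ^ 2 / 2)) := by
  rw [← ofReal_integral_eq_lintegral_ofReal (h.integrable_exp_mul t)
    (Eventually.of_forall fun _ => Real.exp_nonneg _)]
  exact ENNReal.ofReal_le_ofReal (h.mgf_le t)

/-- With a Lebesgue integral in `[0, ∞]`, Tonelli's theorem applies before integrability is known.
-/
theorem hasSubgaussianMGF_of_lintegral_le {Ω : Type*} [MeasurableSpace Ω]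
    {μ : Measure Ω} {X : Ω → ℝ} {c : ℝ≥0} (hX : AEMeasurable X μ)
    (h : ∀ t : ℝ, ∫⁻ ω, ENNReal.ofReal (Real.exp (t * X ω)) ∂μ ≤
      ENNReal.ofReal (Real.exp (c * t ^ 2 / 2))) : HasSubgaussianMGF X c μ := by
  have hm : ∀ t : ℝ, AEStronglyMeasurable (fun ω => Real.exp (t * X ω)) μ := fun t =>
    (Real.measurable_exp.comp_aemeasurable (hX.const_mul t)).aestronglyMeasurable
  have hi : ∀ t : ℝ, Integrable (fun ω => Real.exp (t * X ω)) μ := fun t => by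
    refine ⟨hm t, ?_⟩
    rw [hasFiniteIntegral_iff_ofReal (Eventually.of_forall fun _ => Real.exp_nonneg _)]
    exact (h t).trans_lt ENNReal.ofReal_lt_top
  refine ⟨hi, fun t => ?_⟩
  rw [← ENNReal.ofReal_le_ofReal_iff (Real.exp_nonneg _), mgf,
    ofReal_integral_eq_lintegral_ofReal (hi t) (Eventually.of_forall fun _ => Real.exp_nonneg _)]
  exact h t

theorem one_add_sq_div_two_le_cosh (x : ℝ) : 1 + x ^ 2 / 2 ≤ Real.cosh x := by
  have h1 : Real.cosh x = 1 + 2 * Real.sinh (x / 2) ^ 2 := by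
    have := Real.cosh_two_mul (x / 2)
    rw [Real.cosh_sq, show 2 * (x / 2) = x by ring] at this
    linarith
  have h2 : (x / 2) ^ 2 ≤ Real.sinh (x / 2) ^ 2 := by
    rw [sq_le_sq, Real.abs_sinh]
    exact Real.self_le_sinh_iff.2 (abs_nonneg _)
  rw [h1]; nlinarith

theorem ProbabilityTheory.HasSubgaussianMGF.integral_sq_le {Ω : Type*} [MeasurableSpace Ω]
    {μ : Measure Ω} [IsProbabilityMeasure μ] {X : Ω → ℝ} {c : ℝ≥0} (h : HasSubgaussianMGF X c μ) :
    ∫ ω, X ω ^ 2 ∂μ ≤ 2 * c := by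
  rcases eq_or_ne c 0 with rfl | hc
  · have := h.ae_eq_zero_of_hasSubgaussianMGF_zero
    rw [integral_congr_ae (g := fun _ => (0 : ℝ)) (this.mono fun ω hω => by simp [hω])]
    simp
  have hc0 : 0 < (c : ℝ) := NNReal.coe_pos.2 (pos_iff_ne_zero.2 hc)
  -- At `t² = 1 / c` both exponential moments are at most `√e ≤ 2`, and `(tX)² ≤ 2 cosh (tX) - 2`
  -- then gives the (non-sharp) factor 2.
  set t : ℝ := √(1 / c)
  have ht : t ^ 2 = 1 / c := Real.sq_sqrt (by positivity)
  have hE : ∀ s : ℝ, s ^ 2 = t ^ 2 → ∫ ω, Real.exp (s * X ω) ∂μ ≤ 2 := fun s hs => by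
    have h1 := h.mgf_le s
    rw [hs, ht, mul_one_div_cancel hc0.ne'] at h1
    refine h1.trans ?_
    have h2 : Real.exp (1 / 2) * Real.exp (1 / 2) = Real.exp 1 := by rw [← Real.exp_add]; norm_num
    nlinarith [Real.exp_one_lt_d9, Real.exp_pos (1 / 2)]
  have hi1 := h.integrable_exp_mul t
  have hi2 := h.integrable_exp_mul (-t)
  have hsq : Integrable (fun ω => X ω ^ 2) μ := (h.memLp 2).integrable_sq
  have key : ∫ ω, t ^ 2 * X ω ^ 2 ∂μ ≤
      ∫ ω, (Real.exp (t * X ω) + Real.exp (-t * X ω) - 2) ∂μ := by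
    refine integral_mono (hsq.const_mul _) ((hi1.add hi2).sub (integrable_const _)) fun ω => ?_
    have := one_add_sq_div_two_le_cosh (t * X ω)
    rw [Real.cosh_eq] at this
    simp only [neg_mul]
    nlinarith
  have hrhs : ∫ ω, (Real.exp (t * X ω) + Real.exp (-t * X ω) - 2) ∂μ =
      ∫ ω, Real.exp (t * X ω) ∂μ + ∫ ω, Real.exp (-t * X ω) ∂μ - 2 := by
    have hii : Integrable (fun ω => Real.exp (t * X ω) + Real.exp (-t * X ω)) μ := hi1.add hi2
    rw [integral_sub hii (integrable_const _), integral_add hi1 hi2]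
    simp
  rw [hrhs, integral_const_mul, ht] at key
  have h1 := hE t rfl
  have h2 := hE (-t) (neg_sq t)
  have : 1 / (c : ℝ) * ∫ ω, X ω ^ 2 ∂μ ≤ 2 := by linarith
  rw [one_div, inv_mul_le_iff₀ hc0] at this
  linarith

variable {E W : Type*} [NormedAddCommGroup E] [InnerProductSpace ℝ E] [FiniteDimensional ℝ E]
  [MeasurableSpace E] [BorelSpace E] [NormedAddCommGroup W] [InnerProductSpace ℝ W]
  [FiniteDimensional ℝ W] [MeasurableSpace W] [BorelSpace W]

/-- Averaging over the second variable preserves the Lipschitz constant in the first. Conditionally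
on `x`, the deviation of `h (x, ·)` from this average costs `K₂ L₂²`; the deviation of the average
itself costs `K₁ L₁²`. -/
theorem LipSubgaussian.prod {μ : Measure E} {γ : Measure W} [IsProbabilityMeasure μ]
    [IsProbabilityMeasure γ] {K₁ K₂ L₁ L₂ : ℝ≥0} (hμ : LipSubgaussian μ K₁)
    (hγ : LipSubgaussian γ K₂) {h : E × W → ℝ} (h₁ : ∀ w, LipschitzWith L₁ fun x => h (x, w))
    (h₂ : ∀ x, LipschitzWith L₂ fun w => h (x, w)) :
    HasSubgaussianMGF (fun p => h p - ∫ q, h q ∂(μ.prod γ)) (K₁ * L₁ ^ 2 + K₂ * L₂ ^ 2)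
      (μ.prod γ) := by
  have hc : Continuous h := (LipschitzWith.uncurry (f := fun x w => h (x, w)) h₁ h₂).continuous
  set g : E → ℝ := fun x => ∫ w, h (x, w) ∂γ
  have hg : LipschitzWith L₁ g := by
    refine LipschitzWith.of_dist_le_mul fun x y => ?_
    rw [Real.dist_eq, ← integral_sub (hγ.integrable (h₂ x)) (hγ.integrable (h₂ y)),
      ← Real.norm_eq_abs]
    refine (norm_integral_le_of_norm_le (integrable_const (L₁ * dist x y))
      (Eventually.of_forall fun w => ?_)).trans (by simp)
    rw [← dist_eq_norm]
    exact (h₁ w).dist_le_mul x y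
  set c := ∫ x, g x ∂μ
  have hsub : HasSubgaussianMGF (fun p => h p - c) (K₁ * L₁ ^ 2 + K₂ * L₂ ^ 2) (μ.prod γ) := by
    refine hasSubgaussianMGF_of_lintegral_le (hc.sub continuous_const).aemeasurable fun t => ?_
    have hcont : Continuous fun p => ENNReal.ofReal (Real.exp (t * (h p - c))) :=
      ENNReal.continuous_ofReal.comp (by fun_prop)
    rw [lintegral_prod _ hcont.aemeasurable]
    have hin : ∀ x, ∫⁻ w, ENNReal.ofReal (Real.exp (t * (h (x, w) - c))) ∂γ ≤
        ENNReal.ofReal (Real.exp (t * (g x - c))) *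
          ENNReal.ofReal (Real.exp ((K₂ * L₂ ^ 2 : ℝ≥0) * t ^ 2 / 2)) := fun x => by
      refine le_trans (le_of_eq ?_)
        (mul_le_mul_right ((hγ L₂ _ (h₂ x)).lintegral_exp_mul_le t) _)
      rw [← lintegral_const_mul' _ _ ENNReal.ofReal_ne_top]
      refine lintegral_congr fun w => ?_
      rw [← ENNReal.ofReal_mul (Real.exp_nonneg _), ← Real.exp_add]
      congr 2
      simp only [g]; ring
    refine (lintegral_mono hin).trans ?_
    rw [lintegral_mul_const' _ _ ENNReal.ofReal_ne_top]
    refine (mul_le_mul_left ((hμ L₁ g hg).lintegral_exp_mul_le t) _).trans (le_of_eq ?_)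
    rw [← ENNReal.ofReal_mul (Real.exp_nonneg _), ← Real.exp_add]
    congr 2
    push_cast; ring
  have hint : Integrable h (μ.prod γ) := by
    simpa [Pi.add_def] using! hsub.integrable.add (integrable_const c)
  have hceq : ∫ q, h q ∂(μ.prod γ) = c := integral_prod _ hint
  rwa [hceq]

end SubgaussianTools

/-! ### Operator norms of symmetric operators and nets. -/

section Operators

variable {E : Type*} [NormedAddCommGroup E] [InnerProductSpace ℝ E]

theorem ContinuousLinearMap.opNorm_le_of_abs_inner_le {A : E →L[ℝ] E}
    (hA : (A : E →ₗ[ℝ] E).IsSymmetric) {c : ℝ} (hc : 0 ≤ c)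
    (h : ∀ x, |inner ℝ (A x) x| ≤ c * ‖x‖ ^ 2) : ‖A‖ ≤ c := by
  rw [A.norm_eq_iSup_rayleighQuotient hA]
  refine ciSup_le fun x => ?_
  rw [ContinuousLinearMap.rayleighQuotient, ContinuousLinearMap.reApplyInnerSelf_apply, abs_div,
    abs_sq]
  exact div_le_of_le_mul₀ (sq_nonneg _) hc (h x)

/-- The operator norm of a symmetric operator is controlled by its quadratic form on a
`1/4`-net of the unit ball. -/
theorem ContinuousLinearMap.opNorm_le_of_net {A : E →L[ℝ] E}
    (hA : (A : E →ₗ[ℝ] E).IsSymmetric) {N : Set E} (hN : ∀ u ∈ N, ‖u‖ ≤ 1)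
    (hcov : ∀ x : E, ‖x‖ ≤ 1 → ∃ u ∈ N, ‖x - u‖ ≤ 1 / 4) {t : ℝ}
    (ht : ∀ u ∈ N, |inner ℝ (A u) u| ≤ t) : ‖A‖ ≤ 2 * t := by
  have ht0 : 0 ≤ t := by
    obtain ⟨u, hu, -⟩ := hcov 0 (by simp)
    exact (abs_nonneg _).trans (ht u hu)
  -- Replacing `x` by a net point changes each of the two slots by at most `‖A‖ / 4`; by symmetry
  -- `‖A‖ ≤ t + ‖A‖ / 2`, and the last term is absorbed.
  have hball : ∀ x : E, ‖x‖ ≤ 1 → |inner ℝ (A x) x| ≤ t + ‖A‖ / 2 := by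
    intro x hx
    obtain ⟨u, hu, hxu⟩ := hcov x hx
    have h1 : inner ℝ (A x) x =
        inner ℝ (A u) u + (inner ℝ (A x) (x - u) + inner ℝ (A (x - u)) u) := by
      simp only [inner_sub_right, map_sub, inner_sub_left]; ring
    have h2 : |inner ℝ (A x) (x - u)| ≤ ‖A‖ / 4 :=
      calc |inner ℝ (A x) (x - u)| ≤ ‖A x‖ * ‖x - u‖ := abs_real_inner_le_norm _ _
        _ ≤ (‖A‖ * 1) * (1 / 4) := by gcongr; exact A.le_opNorm_of_le hx
        _ = _ := by ring
    have h3 : |inner ℝ (A (x - u)) u| ≤ ‖A‖ / 4 :=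
      calc |inner ℝ (A (x - u)) u| ≤ ‖A (x - u)‖ * ‖u‖ := abs_real_inner_le_norm _ _
        _ ≤ (‖A‖ * (1 / 4)) * 1 := by
          gcongr
          · exact A.le_opNorm_of_le hxu
          · exact hN u hu
        _ = _ := by ring
    rw [h1]
    refine (abs_add_le _ _).trans ?_
    have := abs_add_le (inner ℝ (A x) (x - u)) (inner ℝ (A (x - u)) u)
    linarith [ht u hu]
  have hfull : ‖A‖ ≤ t + ‖A‖ / 2 := by
    refine A.opNorm_le_of_abs_inner_le hA (by positivity) fun x => ?_
    rcases eq_or_ne x 0 with rfl | hx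
    · simp
    have hx0 : 0 < ‖x‖ := norm_pos_iff.2 hx
    have h1 := hball (‖x‖⁻¹ • x) (by rw [norm_smul, norm_inv, norm_norm, inv_mul_cancel₀ hx0.ne'])
    rw [map_smul, real_inner_smul_left, real_inner_smul_right, ← mul_assoc, abs_mul,
      abs_of_nonneg (by positivity), ← mul_inv, inv_mul_le_iff₀ (by positivity)] at h1
    linarith [h1, sq ‖x‖]
  linarith

/-- The unit ball of a `d`-dimensional space has a `1/4`-net with at most `9 ^ d` points. -/
theorem exists_net_closedBall (E : Type*) [NormedAddCommGroup E] [NormedSpace ℝ E]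
    [FiniteDimensional ℝ E] :
    ∃ N : Finset E, N.card ≤ 9 ^ Module.finrank ℝ E ∧ (∀ u ∈ N, ‖u‖ ≤ 1) ∧
      ∀ x : E, ‖x‖ ≤ 1 → ∃ u ∈ N, ‖x - u‖ ≤ 1 / 4 := by
  classical
  -- A `1/4`-separated set of maximal cardinality is a net. Its balls of radius `1/8` are disjoint
  -- and lie in the ball of radius `9/8`, so comparing volumes gives `9 ^ d`.
  let S : Finset E → Prop := fun s =>
    (∀ c ∈ s, ‖c‖ ≤ 1) ∧ ∀ c ∈ s, ∀ e ∈ s, c ≠ e → 1 / 4 < ‖c - e‖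
  have hcard : ∀ s, S s → s.card ≤ 9 ^ Module.finrank ℝ E := by
    rintro s ⟨hs, h⟩
    borelize E
    let μ : Measure E := Measure.addHaar
    have hD : Set.PairwiseDisjoint (s : Set E) fun c => Metric.ball (c : E) (1 / 8) := by
      intro c hc e he hce
      apply Metric.ball_disjoint_ball
      rw [dist_eq_norm]
      linarith [h c hc e he hce]
    have hsub : (⋃ c ∈ s, Metric.ball (c : E) (1 / 8)) ⊆ Metric.ball (0 : E) (9 / 8) := by
      refine Set.iUnion₂_subset fun x hx => Metric.ball_subset_ball' ?_
      rw [dist_zero_right]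
      linarith [hs x hx]
    have hI : (s.card : ENNReal) * ENNReal.ofReal ((1 / 8) ^ Module.finrank ℝ E) *
        μ (Metric.ball 0 1) ≤
        ENNReal.ofReal ((9 / 8) ^ Module.finrank ℝ E) * μ (Metric.ball 0 1) :=
      calc _ = μ (⋃ c ∈ s, Metric.ball (c : E) (1 / 8)) := by
            rw [measure_biUnion_finset hD fun c _ => measurableSet_ball]
            simp only [μ.addHaar_ball_of_pos _ (by norm_num : (0 : ℝ) < 1 / 8)]
            simp only [Finset.sum_const, nsmul_eq_mul, mul_assoc]
        _ ≤ μ (Metric.ball (0 : E) (9 / 8)) := measure_mono hsub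
        _ = _ := by simp only [μ.addHaar_ball_of_pos _ (by norm_num : (0 : ℝ) < 9 / 8)]
    have hJ := (ENNReal.mul_le_mul_iff_left (Metric.measure_ball_pos _ _ zero_lt_one).ne'
      measure_ball_lt_top.ne).1 hI
    have hK : (s.card : ℝ) ≤ (9 : ℝ) ^ Module.finrank ℝ E := by
      have := ENNReal.toReal_le_of_le_ofReal (by positivity) hJ
      simpa [div_eq_mul_inv, mul_pow] using this
    exact_mod_cast hK
  have hS0 : S ∅ := by simp [S]
  obtain ⟨s, hs, hmax⟩ : ∃ s, S s ∧ ∀ s', S s' → s'.card ≤ s.card := by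
    by_contra! hcon
    have : ∀ k : ℕ, ∃ s, S s ∧ k ≤ s.card := by
      intro k
      induction k with
      | zero => exact ⟨∅, hS0, Nat.zero_le _⟩
      | succ k ih =>
        obtain ⟨s, hs, hk⟩ := ih
        obtain ⟨s', hs', hlt⟩ := hcon s hs
        exact ⟨s', hs', by omega⟩
    obtain ⟨s, hs, hk⟩ := this (9 ^ Module.finrank ℝ E + 1)
    have := hcard s hs
    omega
  refine ⟨s, hcard s hs, hs.1, fun x hx => ?_⟩
  by_contra! hfar
  have hxs : x ∉ s := fun hxs => by
    have := hfar x hxs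
    simp only [sub_self, norm_zero] at this
    norm_num at this
  have := hmax (insert x s) ⟨?_, ?_⟩
  · rw [Finset.card_insert_of_notMem hxs] at this
    omega
  · intro c hc
    rcases Finset.mem_insert.1 hc with rfl | hc
    exacts [hx, hs.1 c hc]
  · intro c hc e he hce
    rcases Finset.mem_insert.1 hc with hc' | hc' <;> rcases Finset.mem_insert.1 he with he' | he'
    · exact absurd (hc'.trans he'.symm) hce
    · rw [hc']; exact hfar e he'
    · rw [he', norm_sub_rev]; exact hfar c hc'
    · exact hs.2 c hc' e he' hce

end Operators

/-! ### Centred vectors. -/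

section Spread

variable {ι : Type*} [Fintype ι]

/-- The vector of deviations of `y` from its mean. -/
noncomputable def centred (y : ι → ℝ) : EuclideanSpace ℝ ι :=
  WithLp.toLp 2 fun i => y i - (∑ j, y j) / Fintype.card ι

/-- Pythagoras: the deviations from the mean are orthogonal to the constants. -/
theorem norm_centred_sq_add [Nonempty ι] (y : ι → ℝ) (c : ℝ) :
    ‖centred y‖ ^ 2 + Fintype.card ι * ((∑ j, y j) / Fintype.card ι - c) ^ 2 =
      ∑ i, (y i - c) ^ 2 := by
  have hn : (Fintype.card ι : ℝ) ≠ 0 := by simp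
  rw [EuclideanSpace.norm_sq_eq]
  simp only [centred, Real.norm_eq_abs, sq_abs, sub_sq, Finset.sum_add_distrib,
    Finset.sum_sub_distrib, ← Finset.sum_mul, ← Finset.mul_sum, Finset.sum_const, nsmul_eq_mul,
    Finset.card_univ]
  field_simp
  ring

theorem norm_centred_sq_le [Nonempty ι] (y : ι → ℝ) (c : ℝ) :
    ‖centred y‖ ^ 2 ≤ ∑ i, (y i - c) ^ 2 := by
  rw [← norm_centred_sq_add y c]
  have : (0 : ℝ) ≤ Fintype.card ι := Nat.cast_nonneg _
  nlinarith [mul_nonneg this (sq_nonneg ((∑ j, y j) / Fintype.card ι - c))]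

theorem abs_norm_centred_sub_le [Nonempty ι] (y z : ι → ℝ) :
    |‖centred y‖ - ‖centred z‖| ≤ √(∑ i, (y i - z i) ^ 2) := by
  have h : centred y - centred z = centred (fun i => y i - z i) := by
    ext i
    simp only [centred, PiLp.sub_apply, Finset.sum_sub_distrib]
    ring
  refine (abs_norm_sub_norm_le _ _).trans (Real.le_sqrt_of_sq_le ?_)
  rw [h]
  simpa using norm_centred_sq_le (fun i => y i - z i) 0

end Spread

/-! ### Contraction of the gradient step. -/

section GradientStep

open scoped NNReal

variable {d : ℕ} {f : EuclideanSpace ℝ (Fin d) → ℝ} {α β η : ℝ}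

/-- The gradient step `x ↦ x - η ∇f(x)`. -/
noncomputable def gradientStep (f : EuclideanSpace ℝ (Fin d) → ℝ) (η : ℝ)
    (x : EuclideanSpace ℝ (Fin d)) : EuclideanSpace ℝ (Fin d) :=
  x - η • gradient f x

/-- The derivative `I - η ∇²f` is symmetric, and its quadratic form lies between `(1 - βη) ‖v‖² ≥ 0`
and `(1 - αη) ‖v‖²`, which bounds its norm. -/
theorem ULA.IsStronglyConvexSmooth.lipschitzWith_gradientStep
    (hf : ULA.IsStronglyConvexSmooth f α β) (hη : 0 < η) (hηβ : η < 1 / β) (hρ : 0 ≤ 1 - α * η) :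
    LipschitzWith ⟨1 - α * η, hρ⟩ (gradientStep f η) := by
  have hβ : 0 < β := hf.pos.trans_le hf.le
  have hηβ' : η * β < 1 := by rwa [lt_div_iff₀ hβ] at hηβ
  -- The inverse Riesz map is conjugate-linear by type; over the reals it is repackaged as a linear
  -- map.
  let J : StrongDual ℝ (EuclideanSpace ℝ (Fin d)) →L[ℝ] EuclideanSpace ℝ (Fin d) :=
    LinearMap.mkContinuous
      { toFun := (InnerProductSpace.toDual ℝ (EuclideanSpace ℝ (Fin d))).symm
        map_add' := fun a b => map_add _ a b
        map_smul' := fun c a => by simp } 1 fun a => by simp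
  have hJ : ∀ (ℓ : StrongDual ℝ (EuclideanSpace ℝ (Fin d))) y, inner ℝ (J ℓ) y = ℓ y :=
    fun ℓ y => InnerProductSpace.toDual_symm_apply
  let T' : EuclideanSpace ℝ (Fin d) →
      EuclideanSpace ℝ (Fin d) →L[ℝ] EuclideanSpace ℝ (Fin d) := fun x =>
    ContinuousLinearMap.id ℝ _ - η • J.comp (fderiv ℝ (fderiv ℝ f) x)
  have hinner : ∀ x v w, inner ℝ (T' x v) w =
      inner ℝ v w - η * fderiv ℝ (fderiv ℝ f) x v w := by
    intro x v w
    simp only [T', sub_apply, smul_apply,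
      ContinuousLinearMap.comp_apply, ContinuousLinearMap.id_apply, inner_sub_left,
      real_inner_smul_left, hJ]
  have hd : ∀ x, HasFDerivAt (gradientStep f η) (T' x) x := by
    intro x
    have h1 : DifferentiableAt ℝ (fderiv ℝ f) x :=
      ((hf.contDiff.fderiv_right (m := 1) (by norm_num)).differentiable (by simp)) x
    exact (hasFDerivAt_id x).sub ((J.hasFDerivAt.comp x h1.hasFDerivAt).const_smul η)
  have hsymm : ∀ x, ((T' x : _ →L[ℝ] _) : EuclideanSpace ℝ (Fin d) →ₗ[ℝ] _).IsSymmetric := by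
    intro x v w
    have h1 : IsSymmSndFDerivAt ℝ f x :=
      (hf.contDiff.contDiffAt).isSymmSndFDerivAt (by simp)
    simp only [ContinuousLinearMap.coe_coe]
    rw [hinner, real_inner_comm (T' x w) v, hinner, h1.eq v w, real_inner_comm]
  have hnorm : ∀ x, ‖T' x‖ ≤ 1 - α * η := by
    intro x
    refine (T' x).opNorm_le_of_abs_inner_le (hsymm x) hρ fun v => ?_
    rw [hinner, real_inner_self_eq_norm_sq]
    have h1 := mul_le_mul_of_nonneg_left (hf.hess_lower x v) hη.le
    have h2 := mul_le_mul_of_nonneg_left (hf.hess_upper x v) hη.le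
    rw [abs_of_nonneg]
    · linarith
    · nlinarith [sq_nonneg ‖v‖]
  refine lipschitzWith_of_nnnorm_fderiv_le (𝕜 := ℝ) (fun x => (hd x).differentiableAt) fun x => ?_
  rw [(hd x).fderiv]
  exact hnorm x

theorem gradientStep_eq_self_of_isMinOn {x : EuclideanSpace ℝ (Fin d)}
    (hx : IsMinOn f Set.univ x) : gradientStep f η x = x := by
  have : fderiv ℝ f x = 0 := (hx.isLocalMin Filter.univ_mem).fderiv_eq_zero
  simp [gradientStep, gradient, this]

end GradientStep

/-! ### Deterministic stability of the noisy iteration. -/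

section NoisyIteration

open scoped NNReal

variable {E : Type*} [NormedAddCommGroup E] [NormedSpace ℝ E]

/-- The iterates of `x ↦ T x + σ ζ` along a noise sequence. -/
def noisyIterate (T : E → E) (σ : ℝ) (x : E) (ζ : ℕ → E) : ℕ → E
  | 0 => x
  | i + 1 => T (noisyIterate T σ x ζ i) + σ • ζ i

variable {T : E → E} {σ : ℝ}

theorem noisyIterate_add (x : E) (ζ : ℕ → E) (k i : ℕ) :
    noisyIterate T σ x ζ (k + i) =
      noisyIterate T σ (noisyIterate T σ x ζ k) (fun j => ζ (k + j)) i := by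
  induction i with
  | zero => rfl
  | succ i ih => rw [← add_assoc]; simp only [noisyIterate, ih]

theorem noisyIterate_congr (x : E) {ζ ζ' : ℕ → E} {i : ℕ} (h : ∀ j < i, ζ j = ζ' j) :
    noisyIterate T σ x ζ i = noisyIterate T σ x ζ' i := by
  induction i with
  | zero => rfl
  | succ i ih =>
    simp only [noisyIterate]
    rw [ih fun j hj => h j (by omega), h i (by omega)]

theorem continuous_noisyIterate (hT : Continuous T) (i : ℕ) :
    Continuous fun p : E × (ℕ → E) => noisyIterate T σ p.1 p.2 i := by
  induction i with
  | zero => exact continuous_fst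
  | succ i ih => simp only [noisyIterate]; fun_prop

variable {ρ : ℝ≥0}

theorem norm_noisyIterate_sub_le_pow (hT : LipschitzWith ρ T) (x y : E) (ζ : ℕ → E) (i : ℕ) :
    ‖noisyIterate T σ x ζ i - noisyIterate T σ y ζ i‖ ≤ (ρ : ℝ) ^ i * ‖x - y‖ := by
  induction i with
  | zero => simp [noisyIterate]
  | succ i ih =>
    simp only [noisyIterate, add_sub_add_right_eq_sub]
    calc _ ≤ ρ * ‖noisyIterate T σ x ζ i - noisyIterate T σ y ζ i‖ := hT.norm_sub_le _ _
      _ ≤ ρ * ((ρ : ℝ) ^ i * ‖x - y‖) := by gcongr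
      _ = _ := by ring

/-- Convexity of the square: `ρ a + b` is the average of `a` and `b / (1 - ρ)` with weights `ρ` and
`1 - ρ`. The recursion is linear in squared distances, so noise contributions add up in `ℓ²`. -/
theorem norm_noisyIterate_succ_sub_sq_le (hT : LipschitzWith ρ T) (hρ : ρ < 1) (x : E)
    (ζ ζ' : ℕ → E) (i : ℕ) :
    ‖noisyIterate T σ x ζ (i + 1) - noisyIterate T σ x ζ' (i + 1)‖ ^ 2 ≤
      ρ * ‖noisyIterate T σ x ζ i - noisyIterate T σ x ζ' i‖ ^ 2 +
        σ ^ 2 * ‖ζ i - ζ' i‖ ^ 2 / (1 - ρ) := by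
  have hρ' : (0 : ℝ) < 1 - ρ := sub_pos.2 (by exact_mod_cast hρ)
  set a := ‖noisyIterate T σ x ζ i - noisyIterate T σ x ζ' i‖
  have h1 : ‖noisyIterate T σ x ζ (i + 1) - noisyIterate T σ x ζ' (i + 1)‖ ≤
      ρ * a + |σ| * ‖ζ i - ζ' i‖ := by
    simp only [noisyIterate, add_sub_add_comm, ← smul_sub]
    refine (norm_add_le _ _).trans (add_le_add (hT.norm_sub_le _ _) ?_)
    rw [norm_smul, Real.norm_eq_abs]
  refine (pow_le_pow_left₀ (norm_nonneg _) h1 2).trans ?_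
  have h2 : σ ^ 2 * ‖ζ i - ζ' i‖ ^ 2 = (|σ| * ‖ζ i - ζ' i‖) ^ 2 := by rw [mul_pow, sq_abs]
  rw [h2]
  generalize |σ| * ‖ζ i - ζ' i‖ = b
  rw [← sub_nonneg]
  have : (ρ : ℝ) * a ^ 2 + b ^ 2 / (1 - ρ) - (ρ * a + b) ^ 2 =
      ρ * (b - (1 - ρ) * a) ^ 2 / (1 - ρ) := by
    field_simp
    ring
  rw [this]
  positivity

theorem norm_noisyIterate_sub_sq_le (hT : LipschitzWith ρ T) (hρ : ρ < 1) (x : E)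
    (ζ ζ' : ℕ → E) (i : ℕ) :
    ‖noisyIterate T σ x ζ i - noisyIterate T σ x ζ' i‖ ^ 2 ≤
      σ ^ 2 / (1 - ρ) * ∑ j ∈ Finset.range i, ‖ζ j - ζ' j‖ ^ 2 := by
  induction i with
  | zero => simp [noisyIterate]
  | succ i ih =>
    refine (norm_noisyIterate_succ_sub_sq_le hT hρ x ζ ζ' i).trans ?_
    rw [Finset.sum_range_succ, mul_add]
    have h1 : (ρ : ℝ) * ‖noisyIterate T σ x ζ i - noisyIterate T σ x ζ' i‖ ^ 2 ≤
        1 * ‖noisyIterate T σ x ζ i - noisyIterate T σ x ζ' i‖ ^ 2 := by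
      gcongr; exact_mod_cast hρ.le
    have h2 : σ ^ 2 * ‖ζ i - ζ' i‖ ^ 2 / (1 - ρ) = σ ^ 2 / (1 - ρ) * ‖ζ i - ζ' i‖ ^ 2 := by ring
    linarith

/-- Summing the one-step recursion and absorbing the `ρ` term into the left side gives a constant
independent of `N`. The range `N + 1` matches `N` noises since the iterate of index 0 is noise-free.
-/
theorem sum_norm_noisyIterate_sub_sq_le (hT : LipschitzWith ρ T) (hρ : ρ < 1) (x : E)
    (ζ ζ' : ℕ → E) (N : ℕ) :
    ∑ i ∈ Finset.range (N + 1), ‖noisyIterate T σ x ζ i - noisyIterate T σ x ζ' i‖ ^ 2 ≤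
      σ ^ 2 / (1 - ρ) ^ 2 * ∑ j ∈ Finset.range N, ‖ζ j - ζ' j‖ ^ 2 := by
  have hρ' : (0 : ℝ) < 1 - ρ := sub_pos.2 (by exact_mod_cast hρ)
  set a : ℕ → ℝ := fun i => ‖noisyIterate T σ x ζ i - noisyIterate T σ x ζ' i‖ ^ 2
  have h0 : a 0 = 0 := by simp [a, noisyIterate]
  have h1 : ∑ i ∈ Finset.range (N + 1), a i ≤
      ρ * ∑ i ∈ Finset.range N, a i +
        σ ^ 2 / (1 - ρ) * ∑ j ∈ Finset.range N, ‖ζ j - ζ' j‖ ^ 2 := by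
    rw [Finset.sum_range_succ', h0, add_zero, Finset.mul_sum, Finset.mul_sum,
      ← Finset.sum_add_distrib]
    refine Finset.sum_le_sum fun i _ => ?_
    refine (norm_noisyIterate_succ_sub_sq_le hT hρ x ζ ζ' i).trans (le_of_eq ?_)
    ring
  have h2 : ∑ i ∈ Finset.range N, a i ≤ ∑ i ∈ Finset.range (N + 1), a i := by
    rw [Finset.sum_range_succ]
    linarith [sq_nonneg ‖noisyIterate T σ x ζ N - noisyIterate T σ x ζ' N‖]
  have h3 := mul_le_mul_of_nonneg_left h2 ρ.coe_nonneg
  have h4 : (1 - ρ) * ∑ i ∈ Finset.range (N + 1), a i ≤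
      σ ^ 2 / (1 - ρ) * ∑ j ∈ Finset.range N, ‖ζ j - ζ' j‖ ^ 2 := by linarith
  rw [mul_comm, ← le_div_iff₀ hρ'] at h4
  refine h4.trans (le_of_eq ?_)
  field_simp

end NoisyIteration

/-! ### Quadratic forms of the sample covariance. -/

section QuadraticForm

variable {d : ℕ}

/-- The quadratic form of a matrix. -/
noncomputable def quadForm (A : Matrix (Fin d) (Fin d) ℝ) (u : EuclideanSpace ℝ (Fin d)) : ℝ :=
  inner ℝ (Matrix.toEuclideanCLM (𝕜 := ℝ) A u) u

theorem inner_toEuclideanCLM (A : Matrix (Fin d) (Fin d) ℝ) (u v : EuclideanSpace ℝ (Fin d)) :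
    inner ℝ (Matrix.toEuclideanCLM (𝕜 := ℝ) A u) v = ∑ j, ∑ k, A j k * (u k * v j) := by
  simp only [PiLp.inner_apply, Matrix.ofLp_toEuclideanCLM, Matrix.mulVec, dotProduct,
    RCLike.inner_apply, conj_trivial, Finset.mul_sum]
  exact Finset.sum_congr rfl fun j _ => Finset.sum_congr rfl fun k _ => by ring

theorem isSymmetric_toEuclideanCLM {A : Matrix (Fin d) (Fin d) ℝ} (hA : A.IsSymm) :
    ((Matrix.toEuclideanCLM (𝕜 := ℝ) A : _ →L[ℝ] _) :
      EuclideanSpace ℝ (Fin d) →ₗ[ℝ] _).IsSymmetric := by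
  intro u v
  simp only [ContinuousLinearMap.coe_coe]
  rw [real_inner_comm _ u, inner_toEuclideanCLM, inner_toEuclideanCLM, Finset.sum_comm]
  refine Finset.sum_congr rfl fun j _ => Finset.sum_congr rfl fun k _ => ?_
  rw [hA.apply j k]; ring

theorem quadForm_sub (A B : Matrix (Fin d) (Fin d) ℝ) (u : EuclideanSpace ℝ (Fin d)) :
    quadForm (A - B) u = quadForm A u - quadForm B u := by
  simp [quadForm, inner_sub_left]

theorem quadForm_vecMulVec (a u : EuclideanSpace ℝ (Fin d)) :
    quadForm (Matrix.vecMulVec a a) u = inner ℝ a u ^ 2 := by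
  rw [quadForm, inner_toEuclideanCLM, sq, PiLp.inner_apply, Finset.sum_mul_sum]
  refine Finset.sum_congr rfl fun j _ => Finset.sum_congr rfl fun k _ => ?_
  simp only [Matrix.vecMulVec_apply, RCLike.inner_apply, conj_trivial]
  ring

theorem quadForm_expect {Ω : Type*} [MeasurableSpace Ω] {P : Measure Ω}
    {A : Ω → Matrix (Fin d) (Fin d) ℝ} (hA : ∀ j k, Integrable (fun ω => A ω j k) P)
    (u : EuclideanSpace ℝ (Fin d)) :
    quadForm (ULA.expect P A) u = ∫ ω, quadForm (A ω) u ∂P := by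
  simp only [quadForm, inner_toEuclideanCLM, ULA.expect, Matrix.of_apply]
  rw [integral_finsetSum _ fun j _ => integrable_finsetSum _ fun k _ => (hA j k).mul_const _]
  refine Finset.sum_congr rfl fun j _ => ?_
  rw [integral_finsetSum _ fun k _ => (hA j k).mul_const _]
  exact Finset.sum_congr rfl fun k _ => (integral_mul_const _ _).symm

/-- The bridge from the matrix to the square of a Lipschitz function of the path. -/
theorem ULA.quadForm_sampleCov {m n : ℕ} (hn : 1 ≤ n) (x : ℕ → EuclideanSpace ℝ (Fin d))
    (u : EuclideanSpace ℝ (Fin d)) :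
    quadForm (ULA.sampleCov m n x) u =
      ‖centred fun i : Finset.Icc (m + 1) (m + n) => inner ℝ (x i) u‖ ^ 2 / n := by
  have hne : Nonempty (Finset.Icc (m + 1) (m + n)) := ⟨⟨m + 1, by simp; omega⟩⟩
  have hcard : (Fintype.card (Finset.Icc (m + 1) (m + n)) : ℝ) = n := by simp
  have h1 := norm_centred_sq_add (fun i : Finset.Icc (m + 1) (m + n) => inner ℝ (x i) u) 0
  rw [hcard, Finset.sum_coe_sort (Finset.Icc (m + 1) (m + n)) fun i => inner ℝ (x i) u,
    Finset.sum_coe_sort (Finset.Icc (m + 1) (m + n)) fun i => (inner ℝ (x i) u - 0) ^ 2] at h1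
  simp only [sub_zero] at h1
  have hn0 : (n : ℝ) ≠ 0 := by positivity
  have h2 : quadForm (ULA.sampleCov m n x) u =
      1 / n * ∑ i ∈ Finset.Icc (m + 1) (m + n), inner ℝ (x i) u ^ 2 -
        (1 / n * ∑ i ∈ Finset.Icc (m + 1) (m + n), inner ℝ (x i) u) ^ 2 := by
    rw [ULA.sampleCov, quadForm_sub, quadForm_vecMulVec]
    congr 1
    · simp only [← quadForm_vecMulVec]
      simp only [quadForm, map_smul, map_sum, smul_apply,
        sum_apply, real_inner_smul_left, sum_inner]
    · simp only [ULA.sampleMean, real_inner_smul_left, sum_inner]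
  rw [h2, ← h1]
  field_simp
  ring

theorem ULA.isSymm_sampleCov (m n : ℕ) (x : ℕ → EuclideanSpace ℝ (Fin d)) :
    (ULA.sampleCov m n x).IsSymm := by
  ext j k
  simp only [ULA.sampleCov, Matrix.transpose_apply, Matrix.sub_apply, Matrix.smul_apply,
    Matrix.sum_apply, Matrix.vecMulVec_apply, mul_comm]

end QuadraticForm

/-! ### Second moments of Gaussian vectors. -/

section GaussianMoments

variable {W : Type*} [NormedAddCommGroup W] [InnerProductSpace ℝ W] [FiniteDimensional ℝ W]
  [MeasurableSpace W] [BorelSpace W]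

theorem integrable_norm_sq_stdGaussian : Integrable (fun z : W => ‖z‖ ^ 2) (stdGaussian W) := by
  simpa using! (lipSubgaussian_stdGaussian (W := W)).integrable_norm_sub_sq 0

theorem integral_inner_stdGaussian (a : W) : ∫ z, inner ℝ a z ∂(stdGaussian W) = 0 := by
  simpa using integral_strongDual_stdGaussian (innerSL ℝ a)

theorem integral_norm_sq_stdGaussian :
    ∫ z, ‖z‖ ^ 2 ∂(stdGaussian W) = Module.finrank ℝ W := by
  have h : ∀ z : W, ‖z‖ ^ 2 = ∑ i, inner ℝ (stdOrthonormalBasis ℝ W i) z ^ 2 := fun z =>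
    ((stdOrthonormalBasis ℝ W).sum_sq_inner_right z).symm
  have h1 : ∀ i, ∫ z, inner ℝ (stdOrthonormalBasis ℝ W i) z ^ 2 ∂(stdGaussian W) = 1 := fun i => by
    have hv := variance_dual_stdGaussian (innerSL ℝ (stdOrthonormalBasis ℝ W i))
    rw [variance_of_integral_eq_zero (by fun_prop) (integral_strongDual_stdGaussian _)] at hv
    simpa using hv
  have h2 : ∀ i ∈ Finset.univ, Integrable
      (fun z => inner ℝ (stdOrthonormalBasis ℝ W i) z ^ 2) (stdGaussian W) := fun i _ => by
    refine integrable_norm_sq_stdGaussian.mono' (by fun_prop) (.of_forall fun z => ?_)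
    rw [Real.norm_of_nonneg (sq_nonneg _), ← sq_abs]
    refine pow_le_pow_left₀ (abs_nonneg _) ?_ 2
    simpa using abs_real_inner_le_norm (stdOrthonormalBasis ℝ W i) z
  simp only [h]
  rw [integral_finsetSum _ h2]
  simp [h1]

theorem integral_norm_add_smul_sq_stdGaussian (a : W) (σ : ℝ) :
    ∫ z, ‖a + σ • z‖ ^ 2 ∂(stdGaussian W) = ‖a‖ ^ 2 + σ ^ 2 * Module.finrank ℝ W := by
  have hi : Integrable (fun z => 2 * σ * inner ℝ a z) (stdGaussian W) :=
    ((IsGaussian.integrable_dual _ (innerSL ℝ a)).const_mul _)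
  have h : ∀ z : W, ‖a + σ • z‖ ^ 2 = ‖a‖ ^ 2 + 2 * σ * inner ℝ a z + σ ^ 2 * ‖z‖ ^ 2 := by
    intro z
    rw [norm_add_sq_real, real_inner_smul_right, norm_smul, mul_pow, Real.norm_eq_abs, sq_abs]
    ring
  simp only [h]
  have hi1 : Integrable (fun z => ‖a‖ ^ 2 + 2 * σ * inner ℝ a z) (stdGaussian W) :=
    (integrable_const _).add hi
  rw [integral_add hi1 (integrable_norm_sq_stdGaussian.const_mul _),
    integral_add (integrable_const _) hi, integral_const_mul, integral_const_mul,
    integral_inner_stdGaussian, integral_norm_sq_stdGaussian]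
  simp

end GaussianMoments

/-! ### Joint laws of the initial value and the noise. -/

section Laws

variable {E : Type*} [NormedAddCommGroup E] [InnerProductSpace ℝ E] [FiniteDimensional ℝ E]
  [MeasurableSpace E] [BorelSpace E] {Ω : Type*} [MeasurableSpace Ω] {P : Measure Ω}
  [IsProbabilityMeasure P]

theorem ProbabilityTheory.IndepFun.prodMk_of_prodMk {α β γ : Type*} [MeasurableSpace α]
    [MeasurableSpace β] [MeasurableSpace γ] {X : Ω → α} {Y : Ω → β} {Z : Ω → γ}
    (hX : Measurable X) (hY : Measurable Y) (hZ : Measurable Z)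
    (h : IndepFun X (fun ω => (Y ω, Z ω)) P) (hYZ : IndepFun Y Z P) :
    IndepFun (fun ω => (X ω, Y ω)) Z P := by
  have hXY : IndepFun X Y P := h.comp measurable_id measurable_fst
  rw [indepFun_iff_map_prod_eq_prod_map_map (by fun_prop) (by fun_prop)] at h hYZ hXY ⊢
  rw [hYZ, ← Measure.prodAssoc_prod, ← hXY] at h
  have h2 := congrArg (Measure.map MeasurableEquiv.prodAssoc.symm) h
  rw [Measure.map_map (by fun_prop) (by fun_prop), Measure.map_map (by fun_prop) (by fun_prop)]
    at h2
  simpa [Function.comp_def, MeasurableEquiv.prodAssoc, Equiv.prodAssoc] using! h2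

/-- `Z₀, Z₁, …` are independent standard Gaussian vectors, jointly independent of `X₀`. -/
structure IsGaussianNoise (P : Measure Ω) (X₀ : Ω → E) (Z : ℕ → Ω → E) : Prop where
  measurable_init : Measurable X₀
  measurable_noise : ∀ i, Measurable (Z i)
  map_noise : ∀ i, P.map (Z i) = stdGaussian E
  iIndepFun_noise : iIndepFun Z P
  indepFun_init : IndepFun X₀ (fun ω i => Z i ω) P

variable {X₀ : Ω → E} {Z : ℕ → Ω → E}

/-- The block `Z_k, …, Z_{k+N-1}` of a noise sequence, as one vector. -/
def noiseBlock (Z : ℕ → Ω → E) (k N : ℕ) (ω : Ω) : PiLp 2 fun _ : Fin N => E :=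
  WithLp.toLp 2 fun j => Z (k + j) ω

theorem IsGaussianNoise.measurable_noiseBlock (h : IsGaussianNoise P X₀ Z) (k N : ℕ) :
    Measurable (noiseBlock Z k N) := by
  have := h.measurable_noise
  unfold noiseBlock
  fun_prop

/-- The characteristic function factorizes. The law does not depend on `k`, which is what the shift
coupling uses. -/
theorem IsGaussianNoise.map_noiseBlock (h : IsGaussianNoise P X₀ Z) (k N : ℕ) :
    P.map (noiseBlock Z k N) = stdGaussian (PiLp 2 fun _ : Fin N => E) := by
  have hind : iIndepFun (fun j : Fin N => Z (k + j)) P :=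
    h.iIndepFun_noise.precomp (g := fun j : Fin N => k + (j : ℕ)) fun i j hij => by
      simpa [Fin.ext_iff] using hij
  have := (h.measurable_noiseBlock k N)
  have := Measure.isProbabilityMeasure_map (μ := P) this.aemeasurable
  refine Measure.ext_of_charFun (funext fun t => ?_)
  have h1 := (iIndepFun_iff_charFun_pi fun j => (h.measurable_noise _).aemeasurable).1 hind t
  refine h1.trans ?_
  rw [charFun_stdGaussian, ← Complex.ofReal_pow, PiLp.norm_sq_eq_of_L2]
  simp only [h.map_noise, charFun_stdGaussian]
  rw [← Complex.exp_sum]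
  push_cast
  rw [← Finset.sum_neg_distrib, Finset.sum_div]

theorem IsGaussianNoise.map_init_noiseBlock (h : IsGaussianNoise P X₀ Z) (k N : ℕ) :
    P.map (fun ω => (X₀ ω, noiseBlock Z k N ω)) =
      (P.map X₀).prod (stdGaussian (PiLp 2 fun _ : Fin N => E)) := by
  rw [← h.map_noiseBlock k N, ← indepFun_iff_map_prod_eq_prod_map_map
    h.measurable_init.aemeasurable (h.measurable_noiseBlock k N).aemeasurable]
  exact h.indepFun_init.comp (φ := id)
    (ψ := fun z : ℕ → E => (WithLp.toLp 2 fun j : Fin N => z (k + j) : PiLp 2 fun _ : Fin N => E))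
    measurable_id (by fun_prop)

/-- A finite block of noise vectors, extended by zero. -/
noncomputable def extendNoise {N : ℕ} (w : PiLp 2 fun _ : Fin N => E) (j : ℕ) : E :=
  if h : j < N then w ⟨j, h⟩ else 0

theorem continuous_extendNoise {N : ℕ} :
    Continuous (extendNoise : (PiLp 2 fun _ : Fin N => E) → ℕ → E) := by
  refine continuous_pi fun j => ?_
  unfold extendNoise
  split_ifs with h
  · fun_prop
  · fun_prop

theorem sum_norm_extendNoise_sub_sq {N : ℕ} (w w' : PiLp 2 fun _ : Fin N => E) :
    ∑ j ∈ Finset.range N, ‖extendNoise w j - extendNoise w' j‖ ^ 2 = ‖w - w'‖ ^ 2 := by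
  rw [PiLp.norm_sq_eq_of_L2, ← Fin.sum_univ_eq_sum_range
    (fun j => ‖extendNoise w j - extendNoise w' j‖ ^ 2)]
  exact Finset.sum_congr rfl fun j _ => by simp [extendNoise]

variable {T : E → E} {σ : ℝ}

theorem noisyIterate_noiseBlock (x : E) (Z : ℕ → Ω → E) (k : ℕ) {i N : ℕ} (hi : i ≤ N) (ω : Ω) :
    noisyIterate T σ x (extendNoise (noiseBlock Z k N ω)) i =
      noisyIterate T σ x (fun j => Z (k + j) ω) i := by
  refine noisyIterate_congr x fun j hj => ?_
  simp [extendNoise, noiseBlock, hj.trans_le hi]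

theorem IsGaussianNoise.measurable_noisyIterate (h : IsGaussianNoise P X₀ Z) (hT : Continuous T)
    (i : ℕ) : Measurable fun ω => noisyIterate T σ (X₀ ω) (fun j => Z j ω) i :=
  (continuous_noisyIterate hT i).measurable.comp
    (h.measurable_init.prodMk (measurable_pi_lambda _ h.measurable_noise))

theorem IsGaussianNoise.map_noisyIterate_noise (h : IsGaussianNoise P X₀ Z) (hT : Continuous T)
    (k : ℕ) :
    P.map (fun ω => (noisyIterate T σ (X₀ ω) (fun j => Z j ω) k, Z k ω)) =
      (P.map fun ω => noisyIterate T σ (X₀ ω) (fun j => Z j ω) k).prod (stdGaussian E) := by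
  rw [← h.map_noise k, ← indepFun_iff_map_prod_eq_prod_map_map
    (h.measurable_noisyIterate hT k).aemeasurable (h.measurable_noise k).aemeasurable]
  have hYZ : IndepFun (fun ω (j : Finset.range k) => Z j ω) (Z k) P := by
    have := h.iIndepFun_noise.indepFun_finset (Finset.range k) {k} (by simp) h.measurable_noise
    exact this.comp (φ := id) (ψ := fun z : ({k} : Finset ℕ) → E => z ⟨k, by simp⟩)
      measurable_id (by fun_prop)
  have hX : IndepFun X₀ (fun ω => ((fun j : Finset.range k => Z j ω), Z k ω)) P :=
    h.indepFun_init.comp (φ := id)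
      (ψ := fun z : ℕ → E => ((fun j : Finset.range k => z j), z k)) measurable_id (by fun_prop)
  have hm := h.measurable_noise
  have hind := hX.prodMk_of_prodMk h.measurable_init (by fun_prop) (hm k) hYZ
  -- The iterate of index `k` sees only the noises before `k`, so padding by zero exhibits it as a
  -- function of variables independent of `Z k`.
  let ext : (Finset.range k → E) → ℕ → E := fun z j =>
    if hj : j ∈ Finset.range k then z ⟨j, hj⟩ else 0
  have hext : Measurable ext := by
    refine measurable_pi_lambda _ fun j => ?_
    by_cases hj : j ∈ Finset.range k
    · simp only [ext, hj, dite_true]; fun_prop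
    · simp only [ext, hj, dite_false]; fun_prop
  have := hind.comp (φ := fun p : E × (Finset.range k → E) => noisyIterate T σ p.1 (ext p.2) k)
    (ψ := id) ((continuous_noisyIterate hT k).measurable.comp
      (measurable_fst.prodMk (hext.comp measurable_snd))) measurable_id
  refine this.congr (.of_forall fun ω => ?_) (.of_forall fun ω => rfl)
  refine noisyIterate_congr _ fun j hj => ?_
  simp [ext, hj]

end Laws

/-! ### Moments and concentration along the random path. -/

section NoisyPath

open scoped NNReal

variable {E : Type*} [NormedAddCommGroup E] [InnerProductSpace ℝ E] [FiniteDimensional ℝ E]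
  [MeasurableSpace E] [BorelSpace E] {Ω : Type*} [MeasurableSpace Ω] {P : Measure Ω}
  [IsProbabilityMeasure P] {X₀ : Ω → E} {Z : ℕ → Ω → E} {T : E → E} {σ : ℝ} {ρ κ : ℝ≥0}

/-- The random iterates of `x ↦ T x + σ Z_i` started at `X₀`. -/
def noisyPath (T : E → E) (σ : ℝ) (X₀ : Ω → E) (Z : ℕ → Ω → E) (i : ℕ) (ω : Ω) : E :=
  noisyIterate T σ (X₀ ω) (fun j => Z j ω) i

theorem IsGaussianNoise.integrable_norm_noise_sq (h : IsGaussianNoise P X₀ Z) (i : ℕ) :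
    Integrable (fun ω => ‖Z i ω‖ ^ 2) P := by
  have h1 := integrable_norm_sq_stdGaussian (W := E)
  rw [← h.map_noise i, integrable_map_measure h1.aestronglyMeasurable
    (h.measurable_noise i).aemeasurable] at h1
  exact h1

/-- The fresh noise is centred and independent of the past, so the cross term vanishes and the
second moment `S` passes to at most `ρ² S + σ² dim E`. The claimed bound is preserved by this map.
-/
theorem IsGaussianNoise.norm_noisyPath_sub_sq (h : IsGaussianNoise P X₀ Z) (hT : LipschitzWith ρ T)
    (hρ : ρ < 1) {a : E} (ha : T a = a) (h0 : Integrable (fun ω => ‖X₀ ω - a‖ ^ 2) P) (k : ℕ) :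
    Integrable (fun ω => ‖noisyPath T σ X₀ Z k ω - a‖ ^ 2) P ∧
      ∫ ω, ‖noisyPath T σ X₀ Z k ω - a‖ ^ 2 ∂P ≤
        ∫ ω, ‖X₀ ω - a‖ ^ 2 ∂P + σ ^ 2 * Module.finrank ℝ E / (1 - ρ) := by
  have hρ' : (0 : ℝ) < 1 - ρ := sub_pos.2 (by exact_mod_cast hρ)
  have hTc := hT.continuous
  have hmeas : ∀ k, Measurable (noisyPath T σ X₀ Z k) := h.measurable_noisyIterate hTc
  induction k with
  | zero =>
    refine ⟨h0, le_add_of_nonneg_right (by positivity)⟩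
  | succ k ih =>
    have hTa : ∀ x, ‖T x - a‖ ^ 2 ≤ (ρ : ℝ) ^ 2 * ‖x - a‖ ^ 2 := fun x => by
      rw [← mul_pow]
      refine pow_le_pow_left₀ (norm_nonneg _) ?_ 2
      simpa [ha] using hT.norm_sub_le x a
    have hstep : ∀ ω, noisyPath T σ X₀ Z (k + 1) ω - a =
        (T (noisyPath T σ X₀ Z k ω) - a) + σ • Z k ω := fun ω => by
      simp only [noisyPath, noisyIterate]; abel
    have hmp := hmeas k
    have hmz := h.measurable_noise k
    have hint : Integrable
        (fun ω => ‖(T (noisyPath T σ X₀ Z k ω) - a) + σ • Z k ω‖ ^ 2) P := by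
      refine ((ih.1.const_mul (2 * ρ ^ 2)).add
        ((h.integrable_norm_noise_sq k).const_mul (2 * σ ^ 2))).mono' ?_ (.of_forall fun ω => ?_)
      · exact Measurable.aestronglyMeasurable (by fun_prop)
      · rw [Real.norm_of_nonneg (sq_nonneg _)]
        simp only [Pi.add_apply]
        have h1 := norm_add_le (T (noisyPath T σ X₀ Z k ω) - a) (σ • Z k ω)
        rw [norm_smul, Real.norm_eq_abs] at h1
        calc _ ≤ (‖T (noisyPath T σ X₀ Z k ω) - a‖ + |σ| * ‖Z k ω‖) ^ 2 := by gcongr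
          _ ≤ 2 * (‖T (noisyPath T σ X₀ Z k ω) - a‖ ^ 2 + (|σ| * ‖Z k ω‖) ^ 2) := add_sq_le
          _ ≤ _ := by
            rw [mul_pow, sq_abs]
            linarith [hTa (noisyPath T σ X₀ Z k ω)]
    refine ⟨by simpa only [hstep] using hint, ?_⟩
    simp only [hstep]
    set G : E × E → ℝ := fun p => ‖(T p.1 - a) + σ • p.2‖ ^ 2
    have hG : Continuous G := by fun_prop
    have hlaw := h.map_noisyIterate_noise (σ := σ) hTc k
    have hpair : AEMeasurable (fun ω => (noisyPath T σ X₀ Z k ω, Z k ω)) P := by fun_prop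
    have hlaw' : P.map (fun ω => (noisyPath T σ X₀ Z k ω, Z k ω)) =
        (P.map (noisyPath T σ X₀ Z k)).prod (stdGaussian E) := hlaw
    have hGi : Integrable G ((P.map (noisyPath T σ X₀ Z k)).prod (stdGaussian E)) := by
      rw [← hlaw', integrable_map_measure hG.aestronglyMeasurable hpair]
      exact hint
    have hprob := Measure.isProbabilityMeasure_map (μ := P) hmp.aemeasurable
    have hsq : Integrable (fun x => ‖x - a‖ ^ 2) (P.map (noisyPath T σ X₀ Z k)) := by
      rw [integrable_map_measure (by fun_prop) hmp.aemeasurable]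
      exact ih.1
    set d : ℝ := (Module.finrank ℝ E : ℝ)
    have hmain : ∫ ω, G (noisyPath T σ X₀ Z k ω, Z k ω) ∂P ≤
        ρ ^ 2 * ∫ ω, ‖noisyPath T σ X₀ Z k ω - a‖ ^ 2 ∂P + σ ^ 2 * d := by
      rw [← integral_map hpair hG.aestronglyMeasurable, hlaw', integral_prod _ hGi]
      simp only [G, integral_norm_add_smul_sq_stdGaussian]
      rw [← integral_map hmp.aemeasurable (f := fun x => ‖x - a‖ ^ 2) (by fun_prop)]
      calc _ ≤ ∫ x, (ρ ^ 2 * ‖x - a‖ ^ 2 + σ ^ 2 * d) ∂(P.map (noisyPath T σ X₀ Z k)) := by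
            refine integral_mono_of_nonneg (.of_forall fun x => by positivity)
              ((hsq.const_mul _).add (integrable_const _)) (.of_forall fun x => ?_)
            simp only [d]
            linarith [hTa x]
        _ = _ := by
            rw [integral_add (hsq.const_mul _) (integrable_const _), integral_const_mul]
            simp
    refine hmain.trans ?_
    have hs : 0 ≤ ∫ ω, ‖X₀ ω - a‖ ^ 2 ∂P := integral_nonneg fun _ => by positivity
    set s := ∫ ω, ‖X₀ ω - a‖ ^ 2 ∂P
    have h2 := mul_le_mul_of_nonneg_left ih.2 (sq_nonneg (ρ : ℝ))
    have h3 : σ ^ 2 * d = (1 - ρ) * (σ ^ 2 * d / (1 - ρ)) := by field_simp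
    have h4 : 0 ≤ σ ^ 2 * d / (1 - ρ) := by positivity
    set A := σ ^ 2 * d / (1 - ρ)
    rw [h3]
    nlinarith [mul_nonneg hρ'.le hs, mul_nonneg hρ'.le h4, ρ.coe_nonneg,
      mul_nonneg ρ.coe_nonneg (mul_nonneg hρ'.le hs), mul_nonneg ρ.coe_nonneg (mul_nonneg hρ'.le h4)]

theorem IsGaussianNoise.memLp_noisyPath (h : IsGaussianNoise P X₀ Z) (hT : LipschitzWith ρ T)
    (hρ : ρ < 1) {a : E} (ha : T a = a) (h0 : Integrable (fun ω => ‖X₀ ω - a‖ ^ 2) P) (k : ℕ) :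
    MemLp (noisyPath T σ X₀ Z k) 2 P := by
  have hm : Measurable (noisyPath T σ X₀ Z k) := h.measurable_noisyIterate hT.continuous k
  have h1 : MemLp (fun ω => noisyPath T σ X₀ Z k ω - a) 2 P :=
    (memLp_two_iff_integrable_sq_norm (by fun_prop)).2 (h.norm_noisyPath_sub_sq hT hρ ha h0 k).1
  simpa [Pi.add_def] using! h1.add (memLp_const a)

theorem IsGaussianNoise.hasSubgaussianMGF (h : IsGaussianNoise P X₀ Z)
    (hκ : LipSubgaussian (P.map X₀) κ) (N : ℕ) {G : E × (PiLp 2 fun _ : Fin N => E) → ℝ}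
    {a b : ℝ} {c : ℝ≥0} (ha : 0 ≤ a) (hb : 0 ≤ b)
    (h₁ : ∀ x y w, |G (x, w) - G (y, w)| ≤ a * ‖x - y‖)
    (h₂ : ∀ x w w', |G (x, w) - G (x, w')| ≤ b * ‖w - w'‖)
    (hc : κ * a ^ 2 + Real.pi ^ 2 / 4 * b ^ 2 ≤ c) :
    HasSubgaussianMGF (fun ω => G (X₀ ω, noiseBlock Z 0 N ω) -
      ∫ ω, G (X₀ ω, noiseBlock Z 0 N ω) ∂P) c P := by
  have hprob := Measure.isProbabilityMeasure_map (μ := P) h.measurable_init.aemeasurable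
  have hl₁ : ∀ w, LipschitzWith ⟨a, ha⟩ fun x => G (x, w) := fun w =>
    LipschitzWith.of_dist_le_mul fun x y => by
      rw [Real.dist_eq, dist_eq_norm]; exact h₁ x y w
  have hl₂ : ∀ x, LipschitzWith ⟨b, hb⟩ fun w => G (x, w) := fun x =>
    LipschitzWith.of_dist_le_mul fun w w' => by
      rw [Real.dist_eq, dist_eq_norm]; exact h₂ x w w'
  have hG : Continuous G := (LipschitzWith.uncurry (f := fun x w => G (x, w)) hl₁ hl₂).continuous
  have hsub := LipSubgaussian.prod hκ
    (lipSubgaussian_stdGaussian (W := PiLp 2 fun _ : Fin N => E)) hl₁ hl₂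
  rw [← h.map_init_noiseBlock 0 N] at hsub
  have hm : AEMeasurable (fun ω => (X₀ ω, noiseBlock Z 0 N ω)) P :=
    (h.measurable_init.prodMk (h.measurable_noiseBlock 0 N)).aemeasurable
  rw [integral_map hm hG.aestronglyMeasurable] at hsub
  have hsub' := hsub.of_map hm
  refine ⟨hsub'.integrable_exp_mul, fun t => (hsub'.mgf_le t).trans (Real.exp_le_exp.2 ?_)⟩
  have hc' : ((κ * ⟨a, ha⟩ ^ 2 + ⟨Real.pi ^ 2 / 4, by positivity⟩ * ⟨b, hb⟩ ^ 2 : ℝ≥0) : ℝ) ≤ c := hc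
  gcongr

theorem IsGaussianNoise.hasSubgaussianMGF_inner_noisyPath (h : IsGaussianNoise P X₀ Z)
    (hκ : LipSubgaussian (P.map X₀) κ) (hT : LipschitzWith ρ T) (hρ : ρ < 1) {u : E}
    (hu : ‖u‖ ≤ 1) (i : ℕ) {c : ℝ≥0}
    (hc : κ * ((ρ : ℝ) ^ i) ^ 2 + Real.pi ^ 2 / 4 * (σ ^ 2 / (1 - ρ)) ≤ c) :
    HasSubgaussianMGF (fun ω => inner ℝ (noisyPath T σ X₀ Z i ω) u -
      ∫ ω, inner ℝ (noisyPath T σ X₀ Z i ω) u ∂P) c P := by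
  have hρ' : (0 : ℝ) < 1 - ρ := sub_pos.2 (by exact_mod_cast hρ)
  have hin : ∀ x y : E, |inner ℝ x u - inner ℝ y u| ≤ ‖x - y‖ := fun x y => by
    rw [← inner_sub_left]
    exact (abs_real_inner_le_norm _ _).trans (mul_le_of_le_one_right (norm_nonneg _) hu)
  have key := h.hasSubgaussianMGF hκ i
    (G := fun p => inner ℝ (noisyIterate T σ p.1 (extendNoise p.2) i) u)
    (a := (ρ : ℝ) ^ i) (b := √(σ ^ 2 / (1 - ρ))) (c := c) (by positivity) (Real.sqrt_nonneg _)
    (fun x y w => (hin _ _).trans (norm_noisyIterate_sub_le_pow hT x y _ i))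
    (fun x w w' => (hin _ _).trans ?_) (by rwa [Real.sq_sqrt (by positivity)])
  · simpa only [noisyIterate_noiseBlock _ Z 0 le_rfl, zero_add] using! key
  · rw [← Real.sqrt_sq (norm_nonneg (w - w')), ← Real.sqrt_mul (by positivity)]
    refine Real.le_sqrt_of_sq_le ?_
    rw [← sum_norm_extendNoise_sub_sq]
    exact norm_noisyIterate_sub_sq_le hT hρ x _ _ i

theorem IsGaussianNoise.hasSubgaussianMGF_norm_centred (h : IsGaussianNoise P X₀ Z)
    (hκ : LipSubgaussian (P.map X₀) κ) (hT : LipschitzWith ρ T) (hρ : ρ < 1) {u : E}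
    (hu : ‖u‖ ≤ 1) {s : Finset ℕ} (hs : s.Nonempty) {c : ℝ≥0}
    (hc : κ * (∑ i ∈ s, ((ρ : ℝ) ^ i) ^ 2) + Real.pi ^ 2 / 4 * (σ ^ 2 / (1 - ρ) ^ 2) ≤ c) :
    HasSubgaussianMGF
      (fun ω => ‖centred fun i : s => inner ℝ (noisyPath T σ X₀ Z i ω) u‖ -
        ∫ ω, ‖centred fun i : s => inner ℝ (noisyPath T σ X₀ Z i ω) u‖ ∂P) c P := by
  have hne : Nonempty s := hs.to_subtype
  obtain ⟨N, hN⟩ : ∃ N, s ⊆ Finset.range (N + 1) :=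
    ⟨s.sup id, fun i hi => Finset.mem_range.2 (Nat.lt_succ_of_le (Finset.le_sup (f := id) hi))⟩
  have hin : ∀ x y : E, (inner ℝ x u - inner ℝ y u) ^ 2 ≤ ‖x - y‖ ^ 2 := fun x y => by
    rw [← inner_sub_left, ← sq_abs]
    exact pow_le_pow_left₀ (abs_nonneg _)
      ((abs_real_inner_le_norm _ _).trans (mul_le_of_le_one_right (norm_nonneg _) hu)) 2
  have hcen : ∀ x y : ℕ → E,
      |‖centred fun i : s => inner ℝ (x i) u‖ - ‖centred fun i : s => inner ℝ (y i) u‖| ≤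
        √(∑ i ∈ s, ‖x i - y i‖ ^ 2) := fun x y => by
    refine (abs_norm_centred_sub_le _ _).trans (Real.sqrt_le_sqrt ?_)
    rw [← Finset.sum_coe_sort s fun i => ‖x i - y i‖ ^ 2]
    exact Finset.sum_le_sum fun i _ => hin _ _
  have key := h.hasSubgaussianMGF hκ N
    (G := fun p => ‖centred fun i : s => inner ℝ (noisyIterate T σ p.1 (extendNoise p.2) i) u‖)
    (a := √(∑ i ∈ s, ((ρ : ℝ) ^ i) ^ 2)) (b := √(σ ^ 2 / (1 - ρ) ^ 2)) (c := c)
    (Real.sqrt_nonneg _) (Real.sqrt_nonneg _)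
    (fun x y w => (hcen _ _).trans ?_) (fun x w w' => (hcen _ _).trans ?_)
    (by rwa [Real.sq_sqrt (by positivity), Real.sq_sqrt (by positivity)])
  · have heq : ∀ ω, (fun i : s => inner ℝ (noisyIterate T σ (X₀ ω)
        (extendNoise (noiseBlock Z 0 N ω)) i) u) =
        fun i : s => inner ℝ (noisyPath T σ X₀ Z i ω) u := fun ω => by
      funext i
      rw [noisyIterate_noiseBlock _ Z 0 (Nat.le_of_lt_succ (Finset.mem_range.1 (hN i.2)))]
      simp only [zero_add, noisyPath]
    simpa only [heq] using! key
  · rw [← Real.sqrt_sq (norm_nonneg (x - y)), ← Real.sqrt_mul (by positivity), Finset.sum_mul]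
    refine Real.sqrt_le_sqrt (Finset.sum_le_sum fun i _ => ?_)
    rw [← mul_pow]
    exact pow_le_pow_left₀ (norm_nonneg _) (norm_noisyIterate_sub_le_pow hT x y _ i) 2
  · rw [← Real.sqrt_sq (norm_nonneg (w - w')), ← Real.sqrt_mul (by positivity)]
    refine Real.sqrt_le_sqrt ?_
    rw [← sum_norm_extendNoise_sub_sq]
    exact (Finset.sum_le_sum_of_subset_of_nonneg hN fun _ _ _ => by positivity).trans
      (sum_norm_noisyIterate_sub_sq_le hT hρ x _ _ N)

/-- The mean iterates converge geometrically: shifting the noise couples the chain started at `X₀`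
with the chain started at `X_k`. -/
theorem IsGaussianNoise.integral_inner_noisyPath_sub_sq_le (h : IsGaussianNoise P X₀ Z)
    (hT : LipschitzWith ρ T) (hρ : ρ < 1) {a : E} (ha : T a = a)
    (h0 : Integrable (fun ω => ‖X₀ ω - a‖ ^ 2) P) {u : E} (hu : ‖u‖ ≤ 1) (i k : ℕ) :
    (∫ ω, inner ℝ (noisyPath T σ X₀ Z i ω) u ∂P -
      ∫ ω, inner ℝ (noisyPath T σ X₀ Z (k + i) ω) u ∂P) ^ 2 ≤
      ((ρ : ℝ) ^ i) ^ 2 *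
        (4 * ∫ ω, ‖X₀ ω - a‖ ^ 2 ∂P + 2 * (σ ^ 2 * Module.finrank ℝ E / (1 - ρ))) := by
  have hTc := hT.continuous
  have hcont : Continuous fun p : E × (PiLp 2 fun _ : Fin i => E) =>
      inner ℝ (noisyIterate T σ p.1 (extendNoise p.2) i) u :=
    ((continuous_noisyIterate hTc i).comp
      (continuous_fst.prodMk (continuous_extendNoise.comp continuous_snd))).inner continuous_const
  have hlaw : ∀ k, ∫ ω, inner ℝ (noisyIterate T σ (X₀ ω) (fun j => Z (k + j) ω) i) u ∂P =
      ∫ p, inner ℝ (noisyIterate T σ p.1 (extendNoise p.2) i) u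
        ∂((P.map X₀).prod (stdGaussian (PiLp 2 fun _ : Fin i => E))) := fun k => by
    rw [← h.map_init_noiseBlock k i, integral_map
      (h.measurable_init.prodMk (h.measurable_noiseBlock k i)).aemeasurable
      hcont.aestronglyMeasurable]
    simp only [noisyIterate_noiseBlock _ Z k le_rfl]
  have hshift : ∫ ω, inner ℝ (noisyPath T σ X₀ Z i ω) u ∂P =
      ∫ ω, inner ℝ (noisyIterate T σ (X₀ ω) (fun j => Z (k + j) ω) i) u ∂P := by
    rw [hlaw k, ← hlaw 0]; simp only [zero_add, noisyPath]
  have hdiff : ∀ ω, |inner ℝ (noisyIterate T σ (X₀ ω) (fun j => Z (k + j) ω) i) u -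
      inner ℝ (noisyPath T σ X₀ Z (k + i) ω) u| ≤
        (ρ : ℝ) ^ i * ‖X₀ ω - noisyPath T σ X₀ Z k ω‖ := fun ω => by
    rw [← inner_sub_left, noisyPath, noisyIterate_add]
    exact ((abs_real_inner_le_norm _ _).trans (mul_le_of_le_one_right (norm_nonneg _) hu)).trans
      (norm_noisyIterate_sub_le_pow hT _ _ _ i)
  have hL0 : MemLp X₀ 2 P := h.memLp_noisyPath (σ := σ) hT hρ ha h0 0
  have hLk : MemLp (noisyPath T σ X₀ Z k) 2 P := h.memLp_noisyPath hT hρ ha h0 k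
  have hLki : MemLp (noisyPath T σ X₀ Z (k + i)) 2 P := h.memLp_noisyPath hT hρ ha h0 (k + i)
  have hD : MemLp (fun ω => ‖X₀ ω - noisyPath T σ X₀ Z k ω‖) 2 P := (hL0.sub hLk).norm
  have hDi : Integrable (fun ω => ‖X₀ ω - noisyPath T σ X₀ Z k ω‖) P := hD.integrable (by norm_num)
  have hki : Integrable (fun ω => inner ℝ (noisyPath T σ X₀ Z (k + i) ω) u) P :=
    (hLki.integrable (by norm_num)).inner_const u
  have hmi : AEStronglyMeasurable
      (fun ω => inner ℝ (noisyIterate T σ (X₀ ω) (fun j => Z (k + j) ω) i) u) P := by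
    have := h.measurable_init
    have hm : Measurable fun ω => noisyIterate T σ (X₀ ω) (fun j => Z (k + j) ω) i :=
      (continuous_noisyIterate hTc i).measurable.comp
        (h.measurable_init.prodMk (measurable_pi_lambda _ fun j => h.measurable_noise _))
    exact Measurable.aestronglyMeasurable (by fun_prop)
  have hsubi : Integrable (fun ω => inner ℝ (noisyIterate T σ (X₀ ω) (fun j => Z (k + j) ω) i) u -
      inner ℝ (noisyPath T σ X₀ Z (k + i) ω) u) P :=
    (hDi.const_mul ((ρ : ℝ) ^ i)).mono' (hmi.sub hki.aestronglyMeasurable)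
      (.of_forall fun ω => by rw [Real.norm_eq_abs]; exact hdiff ω)
  have hii : Integrable
      (fun ω => inner ℝ (noisyIterate T σ (X₀ ω) (fun j => Z (k + j) ω) i) u) P := by
    simpa [Pi.add_def] using! hsubi.add hki
  rw [hshift, ← integral_sub hii hki]
  have h1 : |∫ ω, (inner ℝ (noisyIterate T σ (X₀ ω) (fun j => Z (k + j) ω) i) u -
      inner ℝ (noisyPath T σ X₀ Z (k + i) ω) u) ∂P| ≤
      (ρ : ℝ) ^ i * ∫ ω, ‖X₀ ω - noisyPath T σ X₀ Z k ω‖ ∂P := by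
    rw [← integral_const_mul, ← Real.norm_eq_abs]
    exact norm_integral_le_of_norm_le (hDi.const_mul _)
      (.of_forall fun ω => by rw [Real.norm_eq_abs]; exact hdiff ω)
  -- Jensen's inequality, as nonnegativity of the variance.
  have h2 : (∫ ω, ‖X₀ ω - noisyPath T σ X₀ Z k ω‖ ∂P) ^ 2 ≤
      ∫ ω, ‖X₀ ω - noisyPath T σ X₀ Z k ω‖ ^ 2 ∂P := by
    have := variance_nonneg (fun ω => ‖X₀ ω - noisyPath T σ X₀ Z k ω‖) P
    rw [variance_eq_sub hD] at this
    simpa using this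
  have hk := h.norm_noisyPath_sub_sq (σ := σ) hT hρ ha h0 k
  have h3 : ∫ ω, ‖X₀ ω - noisyPath T σ X₀ Z k ω‖ ^ 2 ∂P ≤
      2 * ∫ ω, ‖X₀ ω - a‖ ^ 2 ∂P + 2 * ∫ ω, ‖noisyPath T σ X₀ Z k ω - a‖ ^ 2 ∂P := by
    rw [← integral_const_mul, ← integral_const_mul,
      ← integral_add (h0.const_mul _) (hk.1.const_mul _)]
    refine integral_mono hD.integrable_sq ((h0.const_mul _).add (hk.1.const_mul _)) fun ω => ?_
    have h4 := norm_sub_le (X₀ ω - a) (noisyPath T σ X₀ Z k ω - a)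
    rw [sub_sub_sub_cancel_right] at h4
    simp only
    calc _ ≤ (‖X₀ ω - a‖ + ‖noisyPath T σ X₀ Z k ω - a‖) ^ 2 := by gcongr
      _ ≤ 2 * (‖X₀ ω - a‖ ^ 2 + ‖noisyPath T σ X₀ Z k ω - a‖ ^ 2) := add_sq_le
      _ = _ := by ring
  rw [← sq_abs]
  refine (pow_le_pow_left₀ (abs_nonneg _) h1 2).trans ?_
  rw [mul_pow]
  have h5 := hk.2
  gcongr
  linarith

end NoisyPath

/-! ### Concentration of the square of a sub-Gaussian variable. -/

section SquareDeviation

open scoped NNReal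

variable {Ω : Type*} [MeasurableSpace Ω] {P : Measure Ω} [IsProbabilityMeasure P]

theorem ProbabilityTheory.HasSubgaussianMGF.memLp_of_centred {H : Ω → ℝ} {c : ℝ} {K : ℝ≥0}
    (h : HasSubgaussianMGF (fun ω => H ω - c) K P) : MemLp H 2 P := by
  simpa [Pi.add_def] using! (h.memLp 2).add (memLp_const c)

/-- Concentration of the square of a sub-Gaussian variable. -/
theorem ProbabilityTheory.HasSubgaussianMGF.measureReal_lt_abs_sq_sub_le {H : Ω → ℝ} {K : ℝ≥0}
    (h : HasSubgaussianMGF (fun ω => H ω - ∫ ω, H ω ∂P) K P) (hK : 0 < K) {V x t : ℝ}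
    (hV : ∫ ω, H ω ^ 2 ∂P ≤ V) (hx : 1 ≤ x) (ht : 2 * √(V * (2 * K * x)) + 2 * K * x ≤ t) :
    P.real {ω | t < |H ω ^ 2 - ∫ ω, H ω ^ 2 ∂P|} ≤ 2 * Real.exp (-x) := by
  have hK' : (0 : ℝ) < K := hK
  have hL := h.memLp_of_centred
  set a := ∫ ω, H ω ∂P
  set b := ∫ ω, H ω ^ 2 ∂P
  have hb0 : 0 ≤ b := integral_nonneg fun _ => sq_nonneg _
  have hvar : ∫ ω, (H ω - a) ^ 2 ∂P = b - a ^ 2 := by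
    have h1 := variance_eq_sub hL
    rw [variance_eq_integral hL.aestronglyMeasurable.aemeasurable] at h1
    simpa using! h1
  have hvar0 : 0 ≤ b - a ^ 2 := hvar ▸ integral_nonneg fun _ => sq_nonneg _
  have hvarK : b - a ^ 2 ≤ 2 * K := hvar ▸ h.integral_sq_le
  set τ := √(2 * K * x)
  have hτ0 : 0 ≤ τ := Real.sqrt_nonneg _
  have hτ : τ ^ 2 = 2 * K * x := Real.sq_sqrt (by positivity)
  have hexp : Real.exp (-τ ^ 2 / (2 * K)) = Real.exp (-x) := by
    rw [hτ]; congr 1; field_simp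
  have h1 := h.measure_ge_le hτ0
  have h2 := h.neg.measure_ge_le hτ0
  rw [hexp] at h1 h2
  have ha : |a| ≤ √V := by
    refine Real.abs_le_sqrt ?_
    linarith
  have ht' : 2 * |a| * τ + τ ^ 2 ≤ t := by
    rw [Real.sqrt_mul (hb0.trans hV)] at ht
    have := mul_le_mul_of_nonneg_right ha hτ0
    linarith
  have hsub : {ω | t < |H ω ^ 2 - b|} ⊆
      {ω | τ ≤ H ω - a} ∪ {ω | τ ≤ (-fun ω => H ω - a) ω} := by
    intro ω hω
    by_contra hcon
    simp only [Set.mem_union, Set.mem_ofPred_eq, Pi.neg_apply, not_or, not_le] at hcon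
    refine absurd hω (not_lt.2 (le_trans ?_ ht'))
    have habs : |H ω - a| ≤ τ := abs_le.2 ⟨by linarith [hcon.2], hcon.1.le⟩
    have hcross : |2 * a * (H ω - a)| ≤ 2 * |a| * τ := by
      rw [abs_mul, abs_mul, abs_two]
      gcongr
    have hsq : (H ω - a) ^ 2 ≤ τ ^ 2 := sq_le_sq.2 (by rwa [abs_of_nonneg hτ0])
    -- The bracket is at most `τ²` in absolute value: above since the variance `b - a²` is
    -- nonnegative, below since the variance is at most `2K ≤ 2Kx = τ²`. This is where `1 ≤ x`
    -- enters.
    have hdec : H ω ^ 2 - b = 2 * a * (H ω - a) + ((H ω - a) ^ 2 - (b - a ^ 2)) := by ring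
    rw [hdec]
    refine (abs_add_le _ _).trans (add_le_add hcross (abs_le.2 ⟨?_, ?_⟩))
    · nlinarith [sq_nonneg (H ω - a)]
    · linarith
  calc P.real {ω | t < |H ω ^ 2 - b|} ≤ _ := measureReal_mono hsub
    _ ≤ _ := measureReal_union_le _ _
    _ ≤ 2 * Real.exp (-x) := by linarith

end SquareDeviation

/-! ### The role of the burn-in: proxy and second moment of `H`. -/

section Variance

open scoped NNReal

variable {E : Type*} [NormedAddCommGroup E] [InnerProductSpace ℝ E] [FiniteDimensional ℝ E]
  [MeasurableSpace E] [BorelSpace E] {Ω : Type*} [MeasurableSpace Ω] {P : Measure Ω}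
  [IsProbabilityMeasure P] {X₀ : Ω → E} {Z : ℕ → Ω → E} {T : E → E} {σ α η : ℝ} {ρ κ : ℝ≥0}

/-- Only one of the two factors `ρ ^ i` is summed; the other keeps the power `ρ ^ (m + 1)` that the
burn-in controls. -/
theorem sum_Icc_sq_pow_le {ρ : ℝ} (h0 : 0 ≤ ρ) (h1 : ρ < 1) (m n : ℕ) :
    ∑ i ∈ Finset.Icc (m + 1) (m + n), (ρ ^ i) ^ 2 ≤ ρ ^ (m + 1) / (1 - ρ) := by
  have hle : ∀ i ∈ Finset.Icc (m + 1) (m + n), (ρ ^ i) ^ 2 ≤ ρ ^ (m + 1) * ρ ^ i := fun i hi => by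
    rw [sq]
    gcongr ?_ * _
    exact pow_le_pow_of_le_one h0 h1.le (Finset.mem_Icc.1 hi).1
  refine (Finset.sum_le_sum hle).trans ?_
  rw [← Finset.mul_sum, div_eq_mul_inv, ← tsum_geometric_of_lt_one h0 h1]
  gcongr
  exact (summable_geometric_of_lt_one h0 h1).sum_le_tsum _ fun _ _ => by positivity

theorem pi_sq_div_four_le : Real.pi ^ 2 / 4 ≤ 5 / 2 := by
  nlinarith [Real.pi_lt_d2, Real.pi_pos]

theorem IsGaussianNoise.integral_norm_centred_sq_le (h : IsGaussianNoise P X₀ Z)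
    (hκ : LipSubgaussian (P.map X₀) κ) (hT : LipschitzWith ρ T) (hρ : (ρ : ℝ) = 1 - α * η)
    (hσ : σ ^ 2 = 2 * η) (hα : 0 < α) (hη : 0 < η) (hαη : α * η < 1) {a : E} (ha : T a = a)
    {m n : ℕ} (hn : 1 ≤ n) (h₁ : κ * (ρ : ℝ) ^ (m + 1) ≤ η)
    (h₂ : 4 * (∫ ω, ‖X₀ ω - a‖ ^ 2 ∂P + Module.finrank ℝ E / α) * (ρ : ℝ) ^ (m + 1) ≤ η * n)
    {u : E} (hu : ‖u‖ ≤ 1) :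
    ∫ ω, ‖centred fun i : Finset.Icc (m + 1) (m + n) => inner ℝ (noisyPath T σ X₀ Z i ω) u‖ ^ 2 ∂P
      ≤ 13 * n / α := by
  have hρ1 : ρ < 1 := by
    rw [← NNReal.coe_lt_one, hρ]; nlinarith
  have hρ' : 1 - (ρ : ℝ) = α * η := by rw [hρ]; ring
  have hprob := Measure.isProbabilityMeasure_map (μ := P) h.measurable_init.aemeasurable
  have h0 : Integrable (fun ω => ‖X₀ ω - a‖ ^ 2) P := by
    have h1 := hκ.integrable_norm_sub_sq a
    rw [integrable_map_measure (by fun_prop) h.measurable_init.aemeasurable] at h1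
    exact h1
  have hne : Nonempty (Finset.Icc (m + 1) (m + n)) := ⟨⟨m + 1, by simp; omega⟩⟩
  set e : ℕ → ℝ := fun i => ∫ ω, inner ℝ (noisyPath T σ X₀ Z i ω) u ∂P
  set s := ∫ ω, ‖X₀ ω - a‖ ^ 2 ∂P
  set d : ℝ := (Module.finrank ℝ E : ℝ)
  have hs : 0 ≤ s := integral_nonneg fun _ => by positivity
  have hL : ∀ i, MemLp (fun ω => inner ℝ (noisyPath T σ X₀ Z i ω) u) 2 P := fun i =>
    (h.memLp_noisyPath hT hρ1 ha h0 i).inner_const u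
  have hvar : ∀ i ∈ Finset.Icc (m + 1) (m + n),
      ∫ ω, (inner ℝ (noisyPath T σ X₀ Z i ω) u - e i) ^ 2 ∂P ≤ 12 / α := by
    intro i hi
    -- The 6 is 1 from the initial value and `5/2 · 2` from the noise.
    have hc : κ * ((ρ : ℝ) ^ i) ^ 2 + Real.pi ^ 2 / 4 * (σ ^ 2 / (1 - ρ)) ≤
        (⟨6 / α, by positivity⟩ : ℝ≥0) := by
      have h1 : κ * ((ρ : ℝ) ^ i) ^ 2 ≤ 1 / α := by
        have h2 : ((ρ : ℝ) ^ i) ^ 2 ≤ (ρ : ℝ) ^ (m + 1) := by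
          rw [← pow_mul]
          refine pow_le_pow_of_le_one ρ.coe_nonneg (by exact_mod_cast hρ1.le) ?_
          have := (Finset.mem_Icc.1 hi).1
          omega
        calc κ * ((ρ : ℝ) ^ i) ^ 2 ≤ κ * (ρ : ℝ) ^ (m + 1) := by gcongr
          _ ≤ η := h₁
          _ ≤ 1 / α := by rw [le_div_iff₀ hα]; linarith
      have h3 : σ ^ 2 / (1 - ρ) = 2 / α := by rw [hρ', hσ]; field_simp
      rw [h3]
      have h4 := mul_le_mul_of_nonneg_right pi_sq_div_four_le (by positivity : 0 ≤ 2 / α)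
      calc _ ≤ 1 / α + 5 / 2 * (2 / α) := add_le_add h1 h4
        _ = 6 / α := by ring
    have h5 := (h.hasSubgaussianMGF_inner_noisyPath hκ hT hρ1 hu i hc).integral_sq_le
    refine h5.trans (le_of_eq ?_)
    change 2 * (6 / α) = 12 / α
    ring
  -- With the last mean as reference point, every index in the window reaches it by a nonnegative
  -- shift, so the coupling bound applies.
  set c := e (m + n)
  have hdec : ∀ i, ∫ ω, (inner ℝ (noisyPath T σ X₀ Z i ω) u - c) ^ 2 ∂P =
      ∫ ω, (inner ℝ (noisyPath T σ X₀ Z i ω) u - e i) ^ 2 ∂P + (e i - c) ^ 2 := by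
    intro i
    have hY := hL i
    have h1 : ∀ r : ℝ, ∫ ω, (inner ℝ (noisyPath T σ X₀ Z i ω) u - r) ^ 2 ∂P =
        ∫ ω, inner ℝ (noisyPath T σ X₀ Z i ω) u ^ 2 ∂P - 2 * r * e i + r ^ 2 := by
      intro r
      have h2 : ∀ ω, (inner ℝ (noisyPath T σ X₀ Z i ω) u - r) ^ 2 =
          inner ℝ (noisyPath T σ X₀ Z i ω) u ^ 2 -
            2 * r * inner ℝ (noisyPath T σ X₀ Z i ω) u + r ^ 2 := fun ω => by ring
      simp only [h2]
      have hi1 := hY.integrable_sq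
      have hi2 := (hY.integrable (by norm_num)).const_mul (2 * r)
      have hi3 : Integrable (fun ω => inner ℝ (noisyPath T σ X₀ Z i ω) u ^ 2 -
          2 * r * inner ℝ (noisyPath T σ X₀ Z i ω) u) P := hi1.sub hi2
      rw [integral_add hi3 (integrable_const _), integral_sub hi1 hi2, integral_const_mul]
      simp [e]
    rw [h1, h1]; ring
  have hbias : ∑ i ∈ Finset.Icc (m + 1) (m + n), (e i - c) ^ 2 ≤ n / α := by
    have h1 : ∀ i ∈ Finset.Icc (m + 1) (m + n),
        (e i - c) ^ 2 ≤ ((ρ : ℝ) ^ i) ^ 2 * (4 * (s + d / α)) := by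
      intro i hi
      have h2 := h.integral_inner_noisyPath_sub_sq_le (σ := σ) hT hρ1 ha h0 hu i (m + n - i)
      rw [Nat.sub_add_cancel (Finset.mem_Icc.1 hi).2] at h2
      refine h2.trans (mul_le_mul_of_nonneg_left (le_of_eq ?_) (by positivity))
      rw [hσ, hρ']
      change 4 * s + 2 * (2 * η * d / (α * η)) = 4 * (s + d / α)
      field_simp
      ring
    refine (Finset.sum_le_sum h1).trans ?_
    rw [← Finset.sum_mul]
    have h3 := sum_Icc_sq_pow_le ρ.coe_nonneg (by exact_mod_cast hρ1) m n
    rw [hρ'] at h3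
    calc _ ≤ (ρ : ℝ) ^ (m + 1) / (α * η) * (4 * (s + d / α)) := by gcongr
      _ = (4 * (s + d / α) * (ρ : ℝ) ^ (m + 1)) / (α * η) := by ring
      _ ≤ (η * n) / (α * η) := by gcongr
      _ = n / α := by field_simp
  have hint : ∀ i ∈ (Finset.univ : Finset (Finset.Icc (m + 1) (m + n))), Integrable
      (fun ω => (inner ℝ (noisyPath T σ X₀ Z i ω) u - c) ^ 2) P := fun i _ =>
    ((hL i).sub (memLp_const c)).integrable_sq
  calc _ ≤ ∫ ω, ∑ i : Finset.Icc (m + 1) (m + n),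
        (inner ℝ (noisyPath T σ X₀ Z i ω) u - c) ^ 2 ∂P :=
        integral_mono_of_nonneg (.of_forall fun _ => by positivity)
          (integrable_finsetSum _ hint) (.of_forall fun ω => norm_centred_sq_le _ c)
    _ = ∑ i ∈ Finset.Icc (m + 1) (m + n),
        ∫ ω, (inner ℝ (noisyPath T σ X₀ Z i ω) u - c) ^ 2 ∂P := by
        rw [integral_finsetSum _ hint, Finset.sum_coe_sort (Finset.Icc (m + 1) (m + n))
          fun i => ∫ ω, (inner ℝ (noisyPath T σ X₀ Z i ω) u - c) ^ 2 ∂P]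
    _ ≤ ∑ _i ∈ Finset.Icc (m + 1) (m + n), 12 / α + n / α := by
        simp only [hdec]
        rw [Finset.sum_add_distrib]
        exact add_le_add (Finset.sum_le_sum hvar) hbias
    _ = 13 * n / α := by simp; ring

/-- The two entries of the maximum cross at `√r = 8`. The 39 is `13 · 3`, from the second moment
bound and the proxy. -/
theorem two_mul_sqrt_add_le {r : ℝ} (hr : 0 ≤ r) :
    2 * √(39 * r) + 3 * r ≤ 8 * max (8 * √r) r := by
  have hq : √r ^ 2 = r := Real.sq_sqrt hr
  have hq0 := Real.sqrt_nonneg r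
  have h39 : √39 ≤ 6.3 := by rw [Real.sqrt_le_left (by norm_num)]; norm_num
  rw [Real.sqrt_mul (by norm_num)]
  have h1 := mul_le_mul_of_nonneg_right h39 hq0
  rcases le_total (√r) 8 with h8 | h8
  · have := le_max_left (8 * √r) r
    nlinarith
  · have := le_max_right (8 * √r) r
    nlinarith

theorem IsGaussianNoise.measureReal_lt_abs_norm_centred_sq_sub_le (h : IsGaussianNoise P X₀ Z)
    (hκ : LipSubgaussian (P.map X₀) κ) (hT : LipschitzWith ρ T) (hρ : (ρ : ℝ) = 1 - α * η)
    (hσ : σ ^ 2 = 2 * η) (hα : 0 < α) (hη : 0 < η) (hαη : α * η < 1) {a : E} (ha : T a = a)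
    {m n : ℕ} (hn : 1 ≤ n) (h₁ : κ * (ρ : ℝ) ^ (m + 1) ≤ η)
    (h₂ : 4 * (∫ ω, ‖X₀ ω - a‖ ^ 2 ∂P + Module.finrank ℝ E / α) * (ρ : ℝ) ^ (m + 1) ≤ η * n)
    {u : E} (hu : ‖u‖ ≤ 1) {x : ℝ} (hx : 1 ≤ x) :
    let H : Ω → ℝ := fun ω =>
      ‖centred fun i : Finset.Icc (m + 1) (m + n) => inner ℝ (noisyPath T σ X₀ Z i ω) u‖
    P.real {ω | n * (8 / α * max (8 * √(4 * x / (α * η * n))) (4 * x / (α * η * n))) <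
      |H ω ^ 2 - ∫ ω, H ω ^ 2 ∂P|} ≤ 2 * Real.exp (-x) := by
  intro H
  have hn0 : (0 : ℝ) < n := by exact_mod_cast hn
  have hρ1 : ρ < 1 := by
    rw [← NNReal.coe_lt_one, hρ]; nlinarith
  have hρ' : 1 - (ρ : ℝ) = α * η := by rw [hρ]; ring
  have hV := h.integral_norm_centred_sq_le hκ hT hρ hσ hα hη hαη ha hn h₁ h₂ hu
  have hs : (Finset.Icc (m + 1) (m + n)).Nonempty := ⟨m + 1, by simp; omega⟩
  have hc : κ * (∑ i ∈ Finset.Icc (m + 1) (m + n), ((ρ : ℝ) ^ i) ^ 2) +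
      Real.pi ^ 2 / 4 * (σ ^ 2 / (1 - ρ) ^ 2) ≤ (⟨6 / (α ^ 2 * η), by positivity⟩ : ℝ≥0) := by
    have h3 := sum_Icc_sq_pow_le ρ.coe_nonneg (by exact_mod_cast hρ1) m n
    rw [hρ'] at h3
    have h4 : κ * (∑ i ∈ Finset.Icc (m + 1) (m + n), ((ρ : ℝ) ^ i) ^ 2) ≤ 1 / (α ^ 2 * η) :=
      calc _ ≤ κ * ((ρ : ℝ) ^ (m + 1) / (α * η)) := by gcongr
        _ = (κ * (ρ : ℝ) ^ (m + 1)) / (α * η) := by ring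
        _ ≤ η / (α * η) := by gcongr
        _ = (α * η) / (α ^ 2 * η) := by field_simp
        _ ≤ 1 / (α ^ 2 * η) := by gcongr
    have h5 : σ ^ 2 / (1 - ρ) ^ 2 = 2 / (α ^ 2 * η) := by rw [hρ', hσ]; field_simp
    rw [h5]
    have h6 := mul_le_mul_of_nonneg_right pi_sq_div_four_le
      (by positivity : 0 ≤ 2 / (α ^ 2 * η))
    calc _ ≤ 1 / (α ^ 2 * η) + 5 / 2 * (2 / (α ^ 2 * η)) := add_le_add h4 h6
      _ = 6 / (α ^ 2 * η) := by ring
  have hsub := h.hasSubgaussianMGF_norm_centred hκ hT hρ1 hu hs hc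
  refine hsub.measureReal_lt_abs_sq_sub_le (V := 13 * n / α)
    (NNReal.coe_pos.1 (by positivity : 0 < 6 / (α ^ 2 * η))) hV hx ?_
  change 2 * √(13 * n / α * (2 * (6 / (α ^ 2 * η)) * x)) + 2 * (6 / (α ^ 2 * η)) * x ≤ _
  have hx0 : 0 ≤ x := by linarith
  -- In this variable `2Kx = (n/α) · 3r`, so the square root becomes `(n/α) √(39 r)`.
  set r := 4 * x / (α * η * n) with hr
  have hr0 : 0 ≤ r := by positivity
  have hxr : 2 * (6 / (α ^ 2 * η)) * x = n / α * (3 * r) := by rw [hr]; field_simp; ring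
  have hsq : 13 * n / α * (n / α * (3 * r)) = (n / α) ^ 2 * (39 * r) := by ring
  rw [hxr, hsq, Real.sqrt_mul (by positivity), Real.sqrt_sq (by positivity)]
  calc _ = n / α * (2 * √(39 * r) + 3 * r) := by ring
    _ ≤ n / α * (8 * max (8 * √r) r) := by gcongr; exact two_mul_sqrt_add_le hr0
    _ = _ := by ring

end Variance

/-! ### From quadratic forms to the operator norm, and numerical constants. -/

section Covariance

open scoped NNReal

theorem ULA.mul_pow_le_of_log_le {ρ a b : ℝ} (hρ : 0 < ρ) (hρ1 : ρ < 1) (ha : 0 ≤ a) (hb : 0 < b)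
    {m : ℕ} (h : Real.log (a / b) / Real.log (1 / ρ) - 1 ≤ m) : a * ρ ^ (m + 1) ≤ b := by
  rcases ha.eq_or_lt with rfl | ha
  · simpa using hb.le
  have hl : 0 < Real.log (1 / ρ) := Real.log_pos (by rw [lt_div_iff₀ hρ]; linarith)
  rw [sub_le_iff_le_add, div_le_iff₀ hl] at h
  have h1 : Real.log (a / b) ≤ Real.log ((1 / ρ) ^ (m + 1)) := by
    rw [Real.log_pow]; exact_mod_cast h
  rw [Real.log_le_log_iff (by positivity) (by positivity), one_div, inv_pow, div_le_iff₀ hb,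
    inv_mul_eq_div, le_div_iff₀ (by positivity)] at h1
  exact h1

theorem ULA.iterate_eq_noisyPath {d : ℕ} {Ω : Type*}
    (f : EuclideanSpace ℝ (Fin d) → ℝ) (η : ℝ)
    (X₀ : Ω → EuclideanSpace ℝ (Fin d)) (Z : ℕ → Ω → EuclideanSpace ℝ (Fin d)) (i : ℕ) (ω : Ω) :
    ULA.iterate f η X₀ Z i ω = noisyPath (gradientStep f η) √(2 * η) X₀ Z i ω := by
  induction i with
  | zero => rfl
  | succ i ih => simp only [ULA.iterate, ih, noisyPath, noisyIterate, gradientStep]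

variable {d : ℕ} {Ω : Type*} [MeasurableSpace Ω] {P : Measure Ω}

theorem ULA.integrable_sampleCov [IsProbabilityMeasure P]
    {X : ℕ → Ω → EuclideanSpace ℝ (Fin d)}
    (hX : ∀ i, MemLp (X i) 2 P) (m n : ℕ) (j k : Fin d) :
    Integrable (fun ω => ULA.sampleCov m n (fun i => X i ω) j k) P := by
  have hc : ∀ i j, MemLp (fun ω => X i ω j) 2 P := fun i j =>
    (EuclideanSpace.proj (𝕜 := ℝ) j).comp_memLp' (hX i)
  have hm : ∀ j, MemLp (fun ω => ULA.sampleMean m n (fun i => X i ω) j) 2 P := fun j => by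
    simp only [ULA.sampleMean, PiLp.smul_apply, WithLp.ofLp_sum, Finset.sum_apply, smul_eq_mul]
    exact (memLp_finsetSum _ fun i _ => hc i j).const_mul _
  simp only [ULA.sampleCov, Matrix.sub_apply, Matrix.smul_apply, Matrix.sum_apply,
    Matrix.vecMulVec_apply, smul_eq_mul]
  exact ((integrable_finsetSum _ fun i _ => (hc i j).integrable_mul (hc i k)).const_mul _).sub
    ((hm j).integrable_mul (hm k))

/-- If the quadratic forms of a random symmetric matrix concentrate uniformly over unit vectors,
then so does the matrix in operator norm. -/
theorem ULA.measureReal_lt_deviation_le [IsProbabilityMeasure P]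
    {A : Ω → Matrix (Fin d) (Fin d) ℝ} (hA : ∀ ω, (A ω).IsSymm)
    (hAi : ∀ j k, Integrable (fun ω => A ω j k) P) {t p : ℝ} (hp : 0 ≤ p)
    (h : ∀ u : EuclideanSpace ℝ (Fin d), ‖u‖ ≤ 1 →
      P.real {ω | t < |quadForm (A ω) u - ∫ ω, quadForm (A ω) u ∂P|} ≤ p) :
    P.real {ω | 2 * t < ULA.deviation P A ω} ≤ 9 ^ d * p := by
  obtain ⟨N, hcard, hN, hcov⟩ := exists_net_closedBall (EuclideanSpace ℝ (Fin d))
  rw [finrank_euclideanSpace_fin] at hcard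
  have hsub : {ω | 2 * t < ULA.deviation P A ω} ⊆
      ⋃ u ∈ N, {ω | t < |quadForm (A ω) u - ∫ ω, quadForm (A ω) u ∂P|} := by
    intro ω hω
    by_contra hcon
    simp only [Set.mem_iUnion, Set.mem_ofPred_eq, not_exists, not_lt] at hcon
    have hE : (ULA.expect P A).IsSymm := by
      ext j k
      simp only [ULA.expect, Matrix.transpose_apply, Matrix.of_apply]
      exact integral_congr_ae (.of_forall fun ω => (hA ω).apply j k)
    refine absurd (show 2 * t < ULA.deviation P A ω from hω) (not_lt.2 ?_)
    refine ContinuousLinearMap.opNorm_le_of_net (N := N)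
      (isSymmetric_toEuclideanCLM ((hA ω).sub hE)) hN hcov fun u hu => ?_
    have h1 := hcon u hu
    rwa [← quadForm_expect hAi, ← quadForm_sub] at h1
  calc P.real {ω | 2 * t < ULA.deviation P A ω} ≤ _ := measureReal_mono hsub (measure_ne_top _ _)
    _ ≤ ∑ u ∈ N, P.real {ω | t < |quadForm (A ω) u - ∫ ω, quadForm (A ω) u ∂P|} :=
        measureReal_biUnion_finset_le _ _
    _ ≤ ∑ _u ∈ N, p := Finset.sum_le_sum fun u hu => h u (hN u hu)
    _ = N.card * p := by simp
    _ ≤ 9 ^ d * p := by gcongr; exact_mod_cast hcard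

theorem one_sub_le_measureReal_of_compl_le [IsProbabilityMeasure P] {φ : Ω → ℝ} {t p : ℝ}
    (h : P.real {ω | t < φ ω} ≤ p) : 1 - p ≤ P.real {ω | φ ω ≤ t} := by
  have h1 : P.real (Set.univ : Set Ω) ≤ P.real {ω | φ ω ≤ t} + P.real {ω | t < φ ω} := by
    refine (measureReal_mono ?_).trans (measureReal_union_le _ _)
    exact fun ω _ => (le_or_gt (φ ω) t)
  rw [probReal_univ] at h1
  linarith

/-- Lets the tail absorb the cardinality `9 ^ d` of the net; the check is `9⁴ ≤ 2.7⁹`. -/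
theorem nine_le_exp : (9 : ℝ) ≤ Real.exp (9 / 4) := by
  have h1 : Real.exp (9 / 4) ^ 4 = Real.exp 1 ^ 9 := by
    rw [← Real.exp_nat_mul, ← Real.exp_nat_mul]; norm_num
  have h2 : (2.7 : ℝ) ^ 9 ≤ Real.exp 1 ^ 9 :=
    pow_le_pow_left₀ (by norm_num) (by linarith [Real.exp_one_gt_d9]) 9
  refine le_of_pow_le_pow_left₀ (n := 4) (by norm_num) (Real.exp_pos _).le ?_
  rw [h1]
  refine le_trans (by norm_num) h2

/-- Uses `e < 4`; it guarantees a tail parameter of at least 1 in every dimension. -/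
theorem one_le_log_inv {δ : ℝ} (hδ : 0 < δ) (hδ4 : δ < 1 / 4) : 1 ≤ Real.log δ⁻¹ := by
  rw [Real.le_log_iff_exp_le (by positivity), le_inv_comm₀ (Real.exp_pos 1) hδ]
  refine hδ4.le.trans ?_
  rw [one_div, inv_le_inv₀ (by norm_num) (Real.exp_pos 1)]
  linarith [Real.exp_one_lt_d9]

theorem nine_pow_mul_exp_le {δ : ℝ} (hδ : 0 < δ) (d : ℕ) :
    9 ^ d * (2 * Real.exp (-((9 * d + 4 * Real.log δ⁻¹) / 4))) ≤ 2 * δ := by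
  have h1 : Real.exp (-((9 * d + 4 * Real.log δ⁻¹) / 4)) = (Real.exp (9 / 4) ^ d)⁻¹ * δ := by
    rw [← Real.exp_nat_mul, ← Real.exp_neg]
    nth_rewrite 2 [← Real.exp_log hδ]
    rw [← Real.exp_add, Real.log_inv]
    congr 1; ring
  rw [h1]
  have h2 : (9 : ℝ) ^ d * (Real.exp (9 / 4) ^ d)⁻¹ ≤ 1 := by
    rw [← div_eq_mul_inv, ← div_pow]
    exact pow_le_one₀ (by positivity) ((div_le_one (Real.exp_pos _)).2 nine_le_exp)
  nlinarith

theorem ULA.deviation_of_subsingleton {A : Ω → Matrix (Fin 0) (Fin 0) ℝ} (ω : Ω) :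
    ULA.deviation P A ω = 0 := by
  rw [ULA.deviation, ULA.opNorm, Subsingleton.elim (A ω - ULA.expect P A) 0]
  simp

theorem explicit_bound_le {D ℓ M α : ℝ} (hD : 0 ≤ D) (hℓ : 0 ≤ ℓ) (hM : 0 < M) (hα : 0 < α) :
    16 / α * max (8 * √((9 * D + 4 * ℓ) / M)) ((9 * D + 4 * ℓ) / M) ≤
      384 * (1 / α * (√((D + ℓ) / M) + (D + ℓ) / M)) := by
  have hq : 0 ≤ (D + ℓ) / M := by positivity
  have h1 : (9 * D + 4 * ℓ) / M ≤ 9 * ((D + ℓ) / M) := by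
    rw [mul_div_assoc']; gcongr; linarith
  have h2 : √((9 * D + 4 * ℓ) / M) ≤ 3 * √((D + ℓ) / M) := by
    refine (Real.sqrt_le_sqrt h1).trans (le_of_eq ?_)
    rw [Real.sqrt_mul (by norm_num), show (9 : ℝ) = 3 ^ 2 by norm_num,
      Real.sqrt_sq (by norm_num)]
  have h3 : max (8 * √((9 * D + 4 * ℓ) / M)) ((9 * D + 4 * ℓ) / M) ≤
      24 * (√((D + ℓ) / M) + (D + ℓ) / M) :=
    max_le (by linarith) (by linarith [Real.sqrt_nonneg ((D + ℓ) / M)])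
  calc _ ≤ 16 / α * (24 * (√((D + ℓ) / M) + (D + ℓ) / M)) := by gcongr
    _ = _ := by ring

theorem order_bound_le {D ℓ M α : ℝ} (hD : 1 ≤ D) (hℓ : 0 ≤ ℓ) (hM : 0 < M) (hα : 0 < α)
    (hDM : D ≤ M) :
    384 * (1 / α * (√((D + ℓ) / M) + (D + ℓ) / M)) ≤
      768 * (1 + |ℓ|) * (1 / α * √(D / M)) := by
  rw [abs_of_nonneg hℓ]
  have hp : 0 ≤ D / M := by positivity
  have hp1 : D / M ≤ 1 := (div_le_one hM).2 hDM
  have hps : D / M ≤ √(D / M) := Real.le_sqrt_of_sq_le (by nlinarith)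
  -- Here `1 ≤ D` absorbs `ℓ` into `ℓ D`.
  have h1 : (D + ℓ) / M ≤ (1 + ℓ) * (D / M) := by
    rw [mul_div_assoc']; gcongr; nlinarith
  have h2 : √((D + ℓ) / M) ≤ (1 + ℓ) * √(D / M) := by
    refine (Real.sqrt_le_sqrt h1).trans ?_
    rw [Real.sqrt_mul (by positivity)]
    gcongr
    exact Real.sqrt_le_iff.2 ⟨by linarith, by nlinarith⟩
  have h3 : (D + ℓ) / M ≤ (1 + ℓ) * √(D / M) := h1.trans (by gcongr)
  calc _ ≤ 384 * (1 / α * ((1 + ℓ) * √(D / M) + (1 + ℓ) * √(D / M))) := by gcongr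
    _ = _ := by ring

theorem ULA.measureReal_lt_deviation_iterateCov_le [IsProbabilityMeasure P] {m n : ℕ} (hn : 1 ≤ n)
    {f : EuclideanSpace ℝ (Fin d) → ℝ} {α β η κ₀ : ℝ}
    {X₀ : Ω → EuclideanSpace ℝ (Fin d)} {Z : ℕ → Ω → EuclideanSpace ℝ (Fin d)}
    {xstar : EuclideanSpace ℝ (Fin d)} (hf : ULA.IsStronglyConvexSmooth f α β)
    (hx : IsMinOn f Set.univ xstar) (hη : 0 < η) (hηβ : η < 1 / β) (hZ : IsGaussianNoise P X₀ Z)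
    (hν : ULA.LSI (P.map X₀) κ₀)
    (hm : ULA.burnIn d n α η κ₀ (∫ ω, ‖X₀ ω - xstar‖ ^ 2 ∂P) ≤ (m : ℝ)) :
    Integrable (fun ω => ‖X₀ ω - xstar‖ ^ 2) P ∧
    (∀ j k, Integrable (fun ω => ULA.iterateCov f η X₀ Z m n ω j k) P) ∧
    ∀ δ : ℝ, 0 < δ → δ < 1 / 4 →
      P.real {ω | 16 / α * max (8 * √((9 * d + 4 * Real.log δ⁻¹) / (α * η * n)))
        ((9 * d + 4 * Real.log δ⁻¹) / (α * η * n)) <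
          ULA.deviation P (ULA.iterateCov f η X₀ Z m n) ω} ≤ 2 * δ := by
  have hα := hf.pos
  have hβ : 0 < β := hα.trans_le hf.le
  have hαη : α * η < 1 := by
    rw [lt_div_iff₀ hβ] at hηβ
    nlinarith [hf.le]
  have hn0 : (0 : ℝ) < n := by exact_mod_cast hn
  have hρ0 : 0 < 1 - α * η := by linarith
  have hρ1 : 1 - α * η < 1 := by nlinarith
  have hT := hf.lipschitzWith_gradientStep hη hηβ hρ0.le
  have ha : gradientStep f η xstar = xstar := gradientStep_eq_self_of_isMinOn hx
  have hprob := Measure.isProbabilityMeasure_map (μ := P) hZ.measurable_init.aemeasurable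
  have hκ := hν.lipSubgaussian
  have h0 : Integrable (fun ω => ‖X₀ ω - xstar‖ ^ 2) P := by
    have h1 := hκ.integrable_norm_sub_sq xstar
    rw [integrable_map_measure (by fun_prop) hZ.measurable_init.aemeasurable] at h1
    exact h1
  have hρ1' : (⟨1 - α * η, hρ0.le⟩ : ℝ≥0) < 1 := hρ1
  have hσ : √(2 * η) ^ 2 = 2 * η := Real.sq_sqrt (by positivity)
  have hs : 0 ≤ ∫ ω, ‖X₀ ω - xstar‖ ^ 2 ∂P := integral_nonneg fun _ => by positivity
  have h₁ : κ₀ * (1 - α * η) ^ (m + 1) ≤ η :=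
    ULA.mul_pow_le_of_log_le hρ0 hρ1 hν.1 hη
      (((le_max_right _ _).trans (le_max_left _ _)).trans hm)
  have h₂ : 4 * (∫ ω, ‖X₀ ω - xstar‖ ^ 2 ∂P + d / α) * (1 - α * η) ^ (m + 1) ≤ η * n :=
    ULA.mul_pow_le_of_log_le hρ0 hρ1 (by positivity) (by positivity) ((le_max_right _ _).trans hm)
  have hcov : ULA.iterateCov f η X₀ Z m n = fun ω => ULA.sampleCov m n fun i =>
      noisyPath (gradientStep f η) √(2 * η) X₀ Z i ω := by
    funext ω
    simp only [ULA.iterateCov, ULA.iterate_eq_noisyPath]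
  have hint : ∀ j k, Integrable (fun ω => ULA.iterateCov f η X₀ Z m n ω j k) P := by
    rw [hcov]
    exact ULA.integrable_sampleCov
      (fun i => hZ.memLp_noisyPath (σ := √(2 * η)) hT hρ1' ha h0 i) m n
  refine ⟨h0, hint, fun δ hδ hδ4 => ?_⟩
  have hℓ := one_le_log_inv hδ hδ4
  set x := (9 * d + 4 * Real.log δ⁻¹) / 4 with hx_def
  have hd0 : (0 : ℝ) ≤ d := Nat.cast_nonneg d
  have hx1 : 1 ≤ x := by rw [hx_def]; linarith
  have h4x : 9 * d + 4 * Real.log δ⁻¹ = 4 * x := by rw [hx_def]; ring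
  -- Half of the final bound, since the net argument doubles the deviation.
  set t := 8 / α * max (8 * √(4 * x / (α * η * n))) (4 * x / (α * η * n)) with ht
  have h2t : 16 / α * max (8 * √(4 * x / (α * η * n))) (4 * x / (α * η * n)) = 2 * t := by
    rw [ht]; ring
  rw [h4x, h2t]
  refine (ULA.measureReal_lt_deviation_le (fun ω => ULA.isSymm_sampleCov _ _ _) hint
    (p := 2 * Real.exp (-x)) (by positivity) fun u hu => ?_).trans (nine_pow_mul_exp_le hδ d)
  have key := hZ.measureReal_lt_abs_norm_centred_sq_sub_le hκ hT rfl hσ hα hη hαη ha hn h₁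
    (by rwa [finrank_euclideanSpace_fin]) hu hx1
  simp only at key
  refine le_trans (measureReal_mono fun ω hω => ?_) key
  simp only [Set.mem_ofPred_eq] at hω ⊢
  simp only [ULA.quadForm_sampleCov hn, ULA.iterate_eq_noisyPath] at hω
  rw [integral_div, ← sub_div, abs_div, abs_of_pos hn0, lt_div_iff₀ hn0] at hω
  linarith

end Covariance

theorem theorem1 :
    ∃ C : ℝ, 0 < C ∧ ∃ K : ℝ → ℝ,
      ∀ (Ω : Type*) [MeasurableSpace Ω] (P : Measure Ω) [IsProbabilityMeasure P]
        (d m n : ℕ) (_ : 1 ≤ n)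
        (f : EuclideanSpace ℝ (Fin d) → ℝ) (α β η κ₀ : ℝ)
        (X₀ : Ω → EuclideanSpace ℝ (Fin d)) (Z : ℕ → Ω → EuclideanSpace ℝ (Fin d))
        (xstar : EuclideanSpace ℝ (Fin d)),
        ULA.IsStronglyConvexSmooth f α β →
        IsMinOn f Set.univ xstar →
        0 < η → η < 1 / β →
        Measurable X₀ → (∀ i, Measurable (Z i)) →
        (∀ i, P.map (Z i) = stdGaussian (EuclideanSpace ℝ (Fin d))) →
        iIndepFun Z P →
        IndepFun X₀ (fun ω i => Z i ω) P →
        ULA.LSI (P.map X₀) κ₀ →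
        ULA.burnIn d n α η κ₀ (∫ ω, ‖X₀ ω - xstar‖ ^ 2 ∂P) ≤ (m : ℝ) →
        -- the expectations in the statement are finite
        Integrable (fun ω => ‖X₀ ω - xstar‖ ^ 2) P ∧
        (∀ j k, Integrable (fun ω => ULA.iterateCov f η X₀ Z m n ω j k) P) ∧
        ∀ δ : ℝ, 0 < δ →
          -- the explicit bound
          1 - 4 * δ ≤ P.real {ω | ULA.deviation P (ULA.iterateCov f η X₀ Z m n) ω ≤
            16 / α * max (8 * √((9 * d + 4 * Real.log δ⁻¹) / (α * η * n)))
              ((9 * d + 4 * Real.log δ⁻¹) / (α * η * n))} ∧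
          -- the order of the bound, with a universal constant
          1 - 4 * δ ≤ P.real {ω | ULA.deviation P (ULA.iterateCov f η X₀ Z m n) ω ≤
            C * (1 / α * (√((d + Real.log δ⁻¹) / (α * η * n))
              + (d + Real.log δ⁻¹) / (α * η * n)))} ∧
          -- the rate for a fixed confidence level
          ((d : ℝ) ≤ α * η * n →
            1 - 4 * δ ≤ P.real {ω | ULA.deviation P (ULA.iterateCov f η X₀ Z m n) ω ≤
              K δ * (1 / α * √(d / (α * η * n)))}) := by
  -- `384 = 16 · 24`, where `24 = 8 · √9`; `768 = 2 · 384`, since for `d ≤ αηn` both terms are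
  -- bounded by the square root.
  refine ⟨384, by norm_num, fun δ => 768 * (1 + |Real.log δ⁻¹|), ?_⟩
  intro Ω _ P _ d m n hn f α β η κ₀ X₀ Z xstar hf hx hη hηβ hX hZ hlaw hind hindX hν hm
  have hnoise : IsGaussianNoise P X₀ Z := ⟨hX, hZ, hlaw, hind, hindX⟩
  obtain ⟨h0, hint, hmain⟩ := ULA.measureReal_lt_deviation_iterateCov_le hn hf hx hη hηβ hnoise hν hm
  refine ⟨h0, hint, fun δ hδ => ?_⟩
  rcases le_or_gt (1 / 4) δ with hδ4 | hδ4
  · have : 1 - 4 * δ ≤ 0 := by linarith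
    exact ⟨this.trans measureReal_nonneg, this.trans measureReal_nonneg,
      fun _ => this.trans measureReal_nonneg⟩
  have hM : 0 < α * η * n := by
    have := hf.pos
    have : (0 : ℝ) < n := by exact_mod_cast hn
    positivity
  have hℓ : 0 ≤ Real.log δ⁻¹ := zero_le_one.trans (one_le_log_inv hδ hδ4)
  have h1 := one_sub_le_measureReal_of_compl_le (hmain δ hδ hδ4)
  have h2 : 1 - 4 * δ ≤ 1 - 2 * δ := by linarith
  have hle := explicit_bound_le (Nat.cast_nonneg d) hℓ hM hf.pos
  refine ⟨h2.trans h1, h2.trans (h1.trans (measureReal_mono fun ω hω => le_trans hω hle)),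
    fun hd => ?_⟩
  -- In dimension 0 the rate vanishes, but so does the deviation.
  rcases Nat.eq_zero_or_pos d with rfl | hd0
  · simp only [ULA.deviation_of_subsingleton]
    have : {ω : Ω | (0 : ℝ) ≤ 768 * (1 + |Real.log δ⁻¹|) *
        (1 / α * √((0 : ℕ) / (α * η * n)))} = Set.univ := by
      ext ω; simp
    rw [this, probReal_univ]
    linarith
  · have hle' := order_bound_le (by exact_mod_cast hd0 : (1 : ℝ) ≤ d) hℓ hM hf.pos hd
    exact h2.trans (h1.trans (measureReal_mono fun ω hω => le_trans hω (hle.trans hle')))
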